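/- Let $k$ be a commutative ring and let $\mathcal{A}=(A=\bigoplus_{i\in\mathbb{Z}}A^i,d)$ be a differential graded (associative, unital) $k$-algebra such that (P1) $A^i=0$ for $i<0$; (P2) $A^0$ is a semisimple ring; (P3) $d(A^0)=0$. Let $\mathrm{dgHot}(\mathcal{A})$ be the homotopy category of dg right $\mathcal{A}$-modules, with shift $\{1\}$ given by $(\{1\}M)^i=M^{i+1}$, $d_{\{1\}M}=-d_M$, and with the triangulated structure whose distinguished triangles are the triangles isomorphic to mapping cone triangles. Let $\mathrm{dgPer}(\mathcal{A})$ be the smallest full triangulated subcategory of $\mathrm{dgHot}(\mathcal{A})$ that contains $\mathcal{A}$ and is closed under direct summands. Let $\mathrm{dgPrae}(\mathcal{A})$ be the smallest strict (that is, closed under isomorphisms) full triangulated subcategory of $\mathrm{dgHot}(\mathcal{A})$ that contains the dg modules $\hat L=L\otimes_{A^0}\mathcal{A}$ for all simple right $A^0$-modules $L$ (placed in degree $0$). For a dg module $M$ put $A^+=\bigoplus_{i>0}A^i$ and $\overline{M}=M/MA^+=M\otimes_{\mathcal{A}}A^0$, and for $n\in\mathbb{Z}$ let $\mathrm{dgPer}^{\le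 n}$ (respectively $\mathrm{dgPer}^{\ge n}$) be the full subcategory of $\mathrm{dgPer}(\mathcal{A})$ of all objects $M$ with $H^i(\overline{M})=0$ for all $i>n$ (respectively for all $i<n$). Then $\mathrm{dgPrae}(\mathcal{A})=\mathrm{dgPer}(\mathcal{A})$, and $(\mathrm{dgPer}^{\le 0},\mathrm{dgPer}^{\ge 0})$ is a t-structure on $\mathrm{dgPer}(\mathcal{A})$, whose shifted halves are the $\mathrm{dgPer}^{\le n}$ and $\mathrm{dgPer}^{\ge n}$, $n\in\mathbb{Z}$. This t-structure is bounded (every object lies in $\mathrm{dgPer}^{\ge a}\cap\mathrm{dgPer}^{\le b}$ for some $a,b\in\mathbb{Z}$) and in particular non-degenerate (an object that lies in $\mathrm{dgPer}^{\le n}$ for all $n$, or in $\mathrm{dgPer}^{\ge n}$ for all $n$, is zero). -/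

import Mathlib

open CategoryTheory CategoryTheory.Limits CategoryTheory.Pretriangulated
open MulOpposite (op)
open scoped TensorProduct

universe w u

noncomputable section

/-- A differential graded `k`-algebra `(A = ⨁_{i ∈ ℤ} A^i, d)`. -/
structure DGAlgebra (k : Type w) [CommRing k] where
  /-- the underlying algebra `A` -/
  carrier : Type u
  [ring : Ring carrier]
  [algebra : Algebra k carrier]
  /-- the homogeneous components `A^i` -/
  gr : ℤ → Submodule k carrier
  [graded : GradedAlgebra gr]
  /-- the differential -/
  d : carrier →ₗ[k] carrier
  d_mem : ∀ {i : ℤ} {a : carrier}, a ∈ gr i → d a ∈ gr (i + 1)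
  d_d : ∀ a, d (d a) = 0
  leibniz : ∀ {i : ℤ} {a : carrier} (b : carrier), a ∈ gr i →
    d (a * b) = d a * b + i.negOnePow • (a * d b)

namespace DGAlgebra

variable {k : Type w} [CommRing k]

instance : CoeSort (DGAlgebra.{w, u} k) (Type u) := ⟨DGAlgebra.carrier⟩

attribute [instance] DGAlgebra.ring DGAlgebra.algebra DGAlgebra.graded

/-- The underlying graded algebra is positively graded: `A^i = 0` for `i < 0`. -/
def IsPositive (A : DGAlgebra.{w, u} k) : Prop := ∀ i : ℤ, i < 0 → A.gr i = ⊥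

/-- The differential vanishes on `A^0`. -/
def ZeroDiff (A : DGAlgebra.{w, u} k) : Prop := ∀ a ∈ A.gr 0, A.d a = 0

end DGAlgebra

/-- A criterion for a family of subgroups to be an internal direct sum decomposition. -/
theorem isInternal_of_proj {M : Type*} [AddCommGroup M] (gr : ℤ → AddSubgroup M)
    (p : ℤ → M →+ M) (same : ∀ i, ∀ x ∈ gr i, p i x = x)
    (ne : ∀ i j, i ≠ j → ∀ x ∈ gr j, p i x = 0)
    (gen : ∀ x, x ∈ ⨆ i, gr i) : DirectSum.IsInternal gr := by
  classical
  constructor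
  · rw [injective_iff_map_eq_zero]
    intro x hx
    have key : ∀ (y : DirectSum ℤ fun i => gr i) (i : ℤ),
        p i (DirectSum.coeAddMonoidHom gr y) = y i := by
      intro y i
      induction y using DirectSum.induction_on with
      | zero => simp
      | of j y =>
        rw [DirectSum.coeAddMonoidHom_of]
        by_cases h : i = j
        · subst h
          rw [same i _ y.2, DirectSum.of_eq_same]
        · rw [ne i j h _ y.2, DirectSum.of_eq_of_ne _ _ _ h]
          rfl
      | add y z hy hz => simp [hy, hz]
    ext i
    have h := key x i
    rw [hx, map_zero] at h
    simpa using h.symm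
  · intro x
    have hx : x ∈ (DirectSum.coeAddMonoidHom gr).range := by
      refine (iSup_le (fun i y hy => ?_) : ⨆ i, gr i ≤ _) (gen x)
      exact ⟨DirectSum.of (fun i => gr i) i ⟨y, hy⟩, by rw [DirectSum.coeAddMonoidHom_of]⟩
    exact hx

variable {k : Type w} [CommRing k]

/-- A dg (right) module over `A`; a right `A`-module is a module over `Aᵐᵒᵖ`, i.e.
`m · a` is written `op a • m`. -/
structure DGMod (A : DGAlgebra.{w, u} k) where
  /-- the underlying right module `M` -/
  carrier : Type u
  [addCommGroup : AddCommGroup carrier]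
  [module : Module (A : Type u)ᵐᵒᵖ carrier]
  /-- the homogeneous components `M^i` -/
  gr : ℤ → AddSubgroup carrier
  isInternal : DirectSum.IsInternal gr
  smul_mem : ∀ {i j : ℤ} {m : carrier} {a : A}, m ∈ gr i → a ∈ A.gr j → op a • m ∈ gr (i + j)
  /-- the differential -/
  d : carrier →+ carrier
  d_mem : ∀ {i : ℤ} {m : carrier}, m ∈ gr i → d m ∈ gr (i + 1)
  d_d : ∀ m, d (d m) = 0
  leibniz : ∀ {i : ℤ} {m : carrier} (a : A), m ∈ gr i →
    d (op a • m) = op a • d m + i.negOnePow • (op (A.d a) • m)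

namespace DGMod

variable {A : DGAlgebra.{w, u} k}

instance : CoeSort (DGMod A) (Type u) := ⟨DGMod.carrier⟩

attribute [instance] DGMod.addCommGroup DGMod.module

/-- The projection of `M` onto `M^i`. -/
def proj (M : DGMod A) (i : ℤ) : M →+ M :=
  letI := M.isInternal.chooseDecomposition
  (M.gr i).subtype.comp ((DFinsupp.evalAddMonoidHom i).comp
    (DirectSum.decomposeAddEquiv M.gr).toAddMonoidHom)

theorem proj_mem (M : DGMod A) (i : ℤ) (x : M) : M.proj i x ∈ M.gr i :=
  SetLike.coe_mem _

theorem proj_same (M : DGMod A) (i : ℤ) (x : M) (hx : x ∈ M.gr i) : M.proj i x = x :=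
  letI := M.isInternal.chooseDecomposition
  DirectSum.decompose_of_mem_same M.gr hx

theorem proj_ne (M : DGMod A) (i j : ℤ) (h : i ≠ j) (x : M) (hx : x ∈ M.gr j) :
    M.proj i x = 0 :=
  letI := M.isInternal.chooseDecomposition
  DirectSum.decompose_of_mem_ne M.gr hx h.symm

theorem mem_iSup (M : DGMod A) (x : M) : x ∈ ⨆ i, M.gr i := by
  classical
  let _ := M.isInternal.chooseDecomposition
  rw [← DirectSum.sum_support_decompose M.gr x]
  exact AddSubgroup.sum_mem _ fun i _ => (le_iSup M.gr i) (SetLike.coe_mem _)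

/-- Morphisms of dg modules: `A`-linear maps of degree zero commuting with the differentials. -/
@[ext]
structure Hom (M N : DGMod A) where
  /-- the underlying `A`-linear map -/
  lin : M →ₗ[(A : Type u)ᵐᵒᵖ] N
  map_mem : ∀ {i : ℤ} {m : M}, m ∈ M.gr i → lin m ∈ N.gr i
  comm : ∀ m, lin (M.d m) = N.d (lin m)

namespace Hom

variable {M N P : DGMod A}

instance : Zero (Hom M N) := ⟨⟨0, fun _ => by simp, fun _ => by simp⟩⟩

instance : Add (Hom M N) := ⟨fun f g => ⟨f.lin + g.lin,
  fun h => by simpa using add_mem (f.map_mem h) (g.map_mem h),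
  fun m => by simp [f.comm, g.comm]⟩⟩

instance : Neg (Hom M N) := ⟨fun f => ⟨-f.lin,
  fun h => by simpa using f.map_mem h, fun m => by simp [f.comm]⟩⟩

instance : AddCommGroup (Hom M N) where
  add_assoc f g h := Hom.ext (add_assoc _ _ _)
  zero_add f := Hom.ext (zero_add _)
  add_zero f := Hom.ext (add_zero _)
  add_comm f g := Hom.ext (add_comm _ _)
  neg_add_cancel f := Hom.ext (neg_add_cancel _)
  nsmul := nsmulRec
  zsmul := zsmulRec

@[simp] theorem lin_zero : (0 : Hom M N).lin = 0 := rfl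
@[simp] theorem lin_add (f g : Hom M N) : (f + g).lin = f.lin + g.lin := rfl
@[simp] theorem lin_neg (f : Hom M N) : (-f).lin = -f.lin := rfl
@[simp] theorem lin_sub (f g : Hom M N) : (f - g).lin = f.lin - g.lin := by
  rw [sub_eq_add_neg, lin_add, lin_neg, sub_eq_add_neg]

/-- The identity morphism. -/
@[simps] def id (M : DGMod A) : Hom M M := ⟨LinearMap.id, fun h => h, fun _ => rfl⟩

/-- `f.comp g` is `f` followed by `g`. -/
@[simps] def comp (f : Hom M N) (g : Hom N P) : Hom M P :=
  ⟨g.lin.comp f.lin, fun h => g.map_mem (f.map_mem h), fun m => by simp [f.comm, g.comm]⟩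

end Hom

/-- The abelian category `dgMod(A)` of dg modules. -/
instance : Category (DGMod A) where
  Hom := Hom
  id := Hom.id
  comp := Hom.comp

/-- `f` is null-homotopic: `f = d h + h d` for an `A`-linear map `h : M → N` of degree `-1`. -/
def IsNull {M N : DGMod A} (f : Hom M N) : Prop :=
  ∃ h : M →ₗ[(A : Type u)ᵐᵒᵖ] N, (∀ (i : ℤ) (m : M), m ∈ M.gr i → h m ∈ N.gr (i - 1)) ∧
    ∀ m, f.lin m = N.d (h m) + h (M.d m)

theorem IsNull.comp_left {M N P : DGMod A} (f : Hom M N) {g : Hom N P} (hg : IsNull g) :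
    IsNull (f.comp g) := by
  obtain ⟨h, h₁, h₂⟩ := hg
  exact ⟨h.comp f.lin, fun i m hm => h₁ i _ (f.map_mem hm), fun m => by simp [h₂, f.comm]⟩

theorem IsNull.comp_right {M N P : DGMod A} {f : Hom M N} (hf : IsNull f) (g : Hom N P) :
    IsNull (f.comp g) := by
  obtain ⟨h, h₁, h₂⟩ := hf
  exact ⟨g.lin.comp h, fun i m hm => g.map_mem (h₁ i m hm), fun m => by simp [h₂, g.comm]⟩

/-- The subgroup of null-homotopic morphisms. -/
def null (M N : DGMod A) : AddSubgroup (Hom M N) where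
  carrier := {f | IsNull f}
  zero_mem' := ⟨0, fun _ _ _ => by simp, fun _ => by simp⟩
  add_mem' := by
    rintro f g ⟨h, h₁, h₂⟩ ⟨h', h₁', h₂'⟩
    refine ⟨h + h', fun i m hm => add_mem (h₁ i m hm) (h₁' i m hm), fun m => ?_⟩
    simp only [Hom.lin_add, LinearMap.add_apply, h₂, h₂', map_add]
    abel
  neg_mem' := by
    rintro f ⟨h, h₁, h₂⟩
    refine ⟨-h, fun i m hm => neg_mem (h₁ i m hm), fun m => ?_⟩
    simp only [Hom.lin_neg, LinearMap.neg_apply, h₂, map_neg]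
    abel

/-- The shift `{n}M`: `({n}M)^i = M^{i+n}` and `d_{{n}M} = (-1)^n d_M`. -/
abbrev shift (M : DGMod A) (n : ℤ) : DGMod A where
  carrier := M
  gr i := M.gr (i + n)
  isInternal := isInternal_of_proj _ (fun i => M.proj (i + n))
    (fun i => M.proj_same (i + n)) (fun i j h => M.proj_ne _ _ (by omega)) (fun x => by
      have h := M.mem_iSup x
      rwa [← (Equiv.addRight n).iSup_comp] at h)
  smul_mem {i j m a} hm ha := by
    have := M.smul_mem hm ha
    rwa [show i + n + j = i + j + n by ring] at this
  d := n.negOnePow • M.d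
  d_mem {i m} hm := by
    have := M.d_mem hm
    rw [show i + n + 1 = i + 1 + n by ring] at this
    rcases Int.units_eq_one_or n.negOnePow with h | h <;> simpa [h] using this
  d_d m := by simp [M.d_d]
  leibniz {i m} a hm := by
    have := M.leibniz a hm
    simp only [AddMonoidHom.smul_apply, this, smul_add, smul_smul, Int.negOnePow_add]
    congr 1
    · rcases Int.units_eq_one_or n.negOnePow with h | h <;> simp [h]
    · rcases Int.units_eq_one_or n.negOnePow with h | h <;> simp [h]

/-- The identity map `{a}M → {b}M` for `a = b`. -/
def shiftCast (M : DGMod A) {a b : ℤ} (h : a = b) : Hom (M.shift a) (M.shift b) where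
  lin := (LinearMap.id : M →ₗ[(A : Type u)ᵐᵒᵖ] M)
  map_mem {i m} hm := by subst h; exact hm
  comm m := by subst h; rfl

/-- The shift of a morphism. -/
def shiftMap {M N : DGMod A} (f : Hom M N) (n : ℤ) : Hom (M.shift n) (N.shift n) where
  lin := f.lin
  map_mem hm := f.map_mem hm
  comm m := by
    rcases Int.units_eq_one_or n.negOnePow with h | h <;> simp [h, f.comm]

theorem IsNull.shiftMap {M N : DGMod A} {f : Hom M N} (hf : IsNull f) (n : ℤ) :
    IsNull (shiftMap f n) := by
  obtain ⟨h, h₁, h₂⟩ := hf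
  let h' : M →ₗ[(A : Type u)ᵐᵒᵖ] N := n.negOnePow • h
  have hh : ∀ x, h' x = n.negOnePow • h x := fun _ => rfl
  refine ⟨h', fun i m hm => ?_, fun m => ?_⟩
  · have := h₁ _ _ hm
    rw [show i + n - 1 = i - 1 + n by ring] at this
    change h' m ∈ N.gr (i - 1 + n)
    rw [hh]
    rcases Int.units_eq_one_or n.negOnePow with h | h <;> simpa [h] using this
  · change f.lin m = n.negOnePow • N.d (h' m) + h' (n.negOnePow • M.d m)
    rw [hh, hh, h₂]
    rcases Int.units_eq_one_or n.negOnePow with h | h <;> simp [h]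

/-- The isomorphism `{0}M → M`. -/
def shiftZero (M : DGMod A) : Hom (M.shift 0) M where
  lin := (LinearMap.id : M →ₗ[(A : Type u)ᵐᵒᵖ] M)
  map_mem {i m} hm := by simpa using hm
  comm m := by simp

/-- The isomorphism `M → {0}M`. -/
def shiftZeroInv (M : DGMod A) : Hom M (M.shift 0) where
  lin := (LinearMap.id : M →ₗ[(A : Type u)ᵐᵒᵖ] M)
  map_mem {i m} hm := by simpa using hm
  comm m := by simp

/-- The isomorphism `{a+b}M → {b}{a}M`. -/
def shiftAdd (M : DGMod A) (a b : ℤ) : Hom (M.shift (a + b)) ((M.shift a).shift b) where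
  lin := (LinearMap.id : M →ₗ[(A : Type u)ᵐᵒᵖ] M)
  map_mem {i m} hm := by
    change m ∈ M.gr (i + b + a)
    rwa [show i + b + a = i + (a + b) by ring]
  comm m := by
    change (a + b).negOnePow • M.d m = b.negOnePow • (a.negOnePow • M.d m)
    rw [smul_smul, Int.negOnePow_add, mul_comm]

/-- The isomorphism `{b}{a}M → {a+b}M`. -/
def shiftAddInv (M : DGMod A) (a b : ℤ) : Hom ((M.shift a).shift b) (M.shift (a + b)) where
  lin := (LinearMap.id : M →ₗ[(A : Type u)ᵐᵒᵖ] M)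
  map_mem {i m} hm := by
    change m ∈ M.gr (i + (a + b))
    rwa [show i + (a + b) = i + b + a by ring]
  comm m := by
    change b.negOnePow • (a.negOnePow • M.d m) = (a + b).negOnePow • M.d m
    rw [smul_smul, Int.negOnePow_add, mul_comm]

/-- The zero dg module. -/
def zero (A : DGAlgebra.{w, u} k) : DGMod A where
  carrier := PUnit
  gr _ := ⊤
  isInternal := isInternal_of_proj _ (fun _ => 0) (fun _ _ _ => rfl) (fun _ _ _ _ _ => rfl)
    (fun _ => (le_iSup (fun _ : ℤ => (⊤ : AddSubgroup PUnit)) 0) trivial)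
  smul_mem _ _ := trivial
  d := 0
  d_mem _ := trivial
  d_d _ := rfl
  leibniz _ _ := rfl

/-- The mapping cone of `f : M → N`: the graded module `N ⊕ {1}M` with differential
`(n, m) ↦ (d n + f m, - d m)`. -/
abbrev cone {M N : DGMod A} (f : Hom M N) : DGMod A where
  carrier := N × M
  gr i := (N.gr i).prod (M.gr (i + 1))
  isInternal := isInternal_of_proj _ (fun i => (N.proj i).prodMap (M.proj (i + 1)))
    (fun i x hx => Prod.ext (N.proj_same _ _ hx.1) (M.proj_same _ _ hx.2))
    (fun i j h x hx => Prod.ext (N.proj_ne _ _ h _ hx.1) (M.proj_ne _ _ (by omega) _ hx.2))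
    (fun x => by
      have h₁ : ∀ n ∈ ⨆ i, N.gr i, ((n, 0) : N × M) ∈ ⨆ i, (N.gr i).prod (M.gr (i + 1)) := by
        intro n hn
        have h : ⨆ i, N.gr i ≤ (⨆ i, (N.gr i).prod (M.gr (i + 1))).comap
            (AddMonoidHom.inl N M) := iSup_le fun i n hn =>
          (le_iSup (fun i => (N.gr i).prod (M.gr (i + 1))) i) ⟨hn, zero_mem _⟩
        exact h hn
      have h₂ : ∀ m ∈ ⨆ i, M.gr i, ((0, m) : N × M) ∈ ⨆ i, (N.gr i).prod (M.gr (i + 1)) := by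
        intro m hm
        have h : ⨆ i, M.gr i ≤ (⨆ i, (N.gr i).prod (M.gr (i + 1))).comap
            (AddMonoidHom.inr N M) := iSup_le fun i m hm =>
          (le_iSup (fun i => (N.gr i).prod (M.gr (i + 1))) (i - 1))
            ⟨zero_mem _, by simpa using hm⟩
        exact h hm
      have := add_mem (h₁ x.1 (N.mem_iSup _)) (h₂ x.2 (M.mem_iSup _))
      simpa using this)
  smul_mem {i j m a} hm ha := ⟨N.smul_mem hm.1 ha, by
    have := M.smul_mem hm.2 ha
    rwa [show i + 1 + j = i + j + 1 by ring] at this⟩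
  d := (N.d.comp (AddMonoidHom.fst N M) + f.lin.toAddMonoidHom.comp (AddMonoidHom.snd N M)).prod
    (-(M.d.comp (AddMonoidHom.snd N M)))
  d_mem {i m} hm := ⟨add_mem (N.d_mem hm.1) (f.map_mem hm.2),
    (M.gr (i + 1 + 1)).neg_mem (M.d_mem hm.2)⟩
  d_d m := by
    ext <;> simp [N.d_d, M.d_d, f.comm]
  leibniz {i m} a hm := by
    ext
    · simp [N.leibniz a hm.1]
      abel
    · simp [M.leibniz a hm.2, Int.negOnePow_succ]
      abel

/-- The inclusion `N → cone f`. -/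
def coneInl {M N : DGMod A} (f : Hom M N) : Hom N (cone f) where
  lin := LinearMap.inl _ N M
  map_mem hn := ⟨hn, zero_mem _⟩
  comm n := by ext <;> simp

/-- The projection `cone f → {1}M`. -/
def coneSnd {M N : DGMod A} (f : Hom M N) : Hom (cone f) (M.shift 1) where
  lin := LinearMap.snd _ N M
  map_mem hx := hx.2
  comm x := by simp

end DGMod

/-- The homotopy category `dgHot(A)`: its objects are dg modules, its morphisms are morphisms
of dg modules modulo null-homotopic ones. -/
structure DGHot (A : DGAlgebra.{w, u} k) where
  /-- a dg module, viewed as an object of the homotopy category -/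
  of ::
  /-- the underlying dg module -/
  as : DGMod A

namespace DGHot

variable {A : DGAlgebra.{w, u} k}

instance : Category (DGHot A) where
  Hom X Y := DGMod.Hom X.as Y.as ⧸ DGMod.null X.as Y.as
  id X := QuotientAddGroup.mk (DGMod.Hom.id X.as)
  comp {X Y Z} f g := Quotient.liftOn₂' f g (fun f g => QuotientAddGroup.mk (f.comp g)) (by
    intro f g f' g' hf hg
    rw [QuotientAddGroup.leftRel_apply] at hf hg
    refine (QuotientAddGroup.eq).2 ?_
    have := add_mem (show (-f + f').comp g' ∈ DGMod.null X.as Z.as from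
      DGMod.IsNull.comp_right hf g') (show f.comp (-g + g') ∈ DGMod.null X.as Z.as from
      DGMod.IsNull.comp_left f hg)
    convert this using 1
    ext x
    simp only [DGMod.Hom.lin_add, DGMod.Hom.lin_neg, DGMod.Hom.comp_lin, LinearMap.add_apply,
      LinearMap.neg_apply, LinearMap.comp_apply, map_add, map_neg]
    abel)
  id_comp f := by
    induction f using QuotientAddGroup.induction_on with | _ f => rfl
  comp_id f := by
    induction f using QuotientAddGroup.induction_on with | _ f => rfl
  assoc f g h := by
    induction f using QuotientAddGroup.induction_on with | _ f =>
    induction g using QuotientAddGroup.induction_on with | _ g =>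
    induction h using QuotientAddGroup.induction_on with | _ h => rfl

/-- The homotopy class of a morphism of dg modules. -/
def mk {M N : DGMod A} (f : DGMod.Hom M N) : (⟨M⟩ : DGHot A) ⟶ ⟨N⟩ := QuotientAddGroup.mk f

theorem mk_surj {X Y : DGHot A} (f : X ⟶ Y) : ∃ f' : DGMod.Hom X.as Y.as, mk f' = f :=
  QuotientAddGroup.mk_surjective f

instance : Preadditive (DGHot A) where
  homGroup X Y := inferInstanceAs (AddCommGroup (DGMod.Hom X.as Y.as ⧸ DGMod.null X.as Y.as))
  add_comp X Y Z f f' g := by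
    obtain ⟨f, rfl⟩ := mk_surj f
    obtain ⟨f', rfl⟩ := mk_surj f'
    obtain ⟨g, rfl⟩ := mk_surj g
    exact congrArg mk (show (f + f').comp g = f.comp g + f'.comp g by ext x; simp)
  comp_add X Y Z f g g' := by
    obtain ⟨f, rfl⟩ := mk_surj f
    obtain ⟨g, rfl⟩ := mk_surj g
    obtain ⟨g', rfl⟩ := mk_surj g'
    exact congrArg mk (show f.comp (g + g') = f.comp g + f.comp g' by ext x; simp)

section

variable {M N P : DGMod A}

theorem mk_comp (f : DGMod.Hom M N) (g : DGMod.Hom N P) : mk f ≫ mk g = mk (f.comp g) := rfl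
theorem mk_id (M : DGMod A) : 𝟙 (⟨M⟩ : DGHot A) = mk (DGMod.Hom.id M) := rfl
theorem mk_neg (f : DGMod.Hom M N) : -mk f = mk (-f) := rfl
theorem mk_zero : (0 : (⟨M⟩ : DGHot A) ⟶ ⟨N⟩) = mk 0 := rfl
theorem mk_add (f g : DGMod.Hom M N) : mk f + mk g = mk (f + g) := rfl

theorem mk_eq_iff (f g : DGMod.Hom M N) : mk f = mk g ↔ DGMod.IsNull (f - g) := by
  rw [← sub_eq_zero]
  exact QuotientAddGroup.eq_zero_iff (f - g)

theorem mk_eq_of_lin {f g : DGMod.Hom M N} (h : ∀ x, f.lin x = g.lin x) : mk f = mk g :=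
  congrArg mk (DGMod.Hom.ext (LinearMap.ext h))

end

instance : HasZeroObject (DGHot A) := by
  refine ⟨⟨DGMod.zero A⟩, (IsZero.iff_id_eq_zero _).2 ?_⟩
  exact mk_eq_of_lin fun _ => rfl

/-- The shift functor `{n}` on the homotopy category. -/
def shiftF (n : ℤ) : DGHot A ⥤ DGHot A where
  obj X := ⟨X.as.shift n⟩
  map {X Y} f := QuotientAddGroup.map (DGMod.null X.as Y.as)
    (DGMod.null (X.as.shift n) (Y.as.shift n))
    { toFun := fun f => DGMod.shiftMap f n
      map_zero' := rfl
      map_add' := fun _ _ => rfl } (fun f hf => DGMod.IsNull.shiftMap hf n) f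
  map_id X := rfl
  map_comp f g := by
    obtain ⟨f, rfl⟩ := mk_surj f
    obtain ⟨g, rfl⟩ := mk_surj g
    rfl

theorem shiftF_map {M N : DGMod A} (f : DGMod.Hom M N) (n : ℤ) :
    (shiftF n).map (mk f) = mk (DGMod.shiftMap f n) := rfl

theorem eqToHom_shift (X : DGHot A) {a b : ℤ} (h : a = b)
    (h' : (shiftF a).obj X = (shiftF b).obj X) :
    eqToHom h' = mk (DGMod.shiftCast X.as h) := by
  subst h
  rfl

instance : HasShift (DGHot A) ℤ := hasShiftMk _ _
  { F := shiftF
    zero := NatIso.ofComponents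
      (fun X => ⟨mk (DGMod.shiftZero X.as), mk (DGMod.shiftZeroInv X.as), rfl, rfl⟩) (by
        intro X Y f
        obtain ⟨f, rfl⟩ := mk_surj f
        rfl)
    add := fun a b => NatIso.ofComponents
      (fun X => ⟨mk (DGMod.shiftAdd X.as a b), mk (DGMod.shiftAddInv X.as a b), rfl, rfl⟩) (by
        intro X Y f
        obtain ⟨f, rfl⟩ := mk_surj f
        rfl)
    assoc_hom_app := fun a b c X => by
      erw [eqToHom_shift X (add_assoc a b c)]
      rfl
    zero_add_hom_app := fun n X => by
      erw [eqToHom_shift X (zero_add n)]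
      rfl
    add_zero_hom_app := fun n X => by
      erw [eqToHom_shift X (add_zero n)]
      rfl }

theorem shift_map {M N : DGMod A} (f : DGMod.Hom M N) (n : ℤ) :
    (mk f)⟦n⟧' = mk (DGMod.shiftMap f n) := rfl

instance (n : ℤ) : (shiftFunctor (DGHot A) n).Additive where
  map_add {X Y f g} := by
    obtain ⟨f, rfl⟩ := mk_surj f
    obtain ⟨g, rfl⟩ := mk_surj g
    rfl

/-- The standard triangle `M → N → cone f → {1}M` of a morphism `f : M → N` of dg modules. -/
def stdTriangle {M N : DGMod A} (f : DGMod.Hom M N) : Triangle (DGHot A) :=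
  Triangle.mk (mk f) (mk (DGMod.coneInl f)) (mk (DGMod.coneSnd f))

/-- The distinguished triangles are the triangles isomorphic to a standard triangle. -/
def distTriangles (A : DGAlgebra.{w, u} k) : Set (Triangle (DGHot A)) :=
  {T | ∃ (M N : DGMod A) (f : DGMod.Hom M N), Nonempty (T ≅ stdTriangle f)}

theorem isZero_cone_id (M : DGMod A) :
    IsZero (⟨DGMod.cone (DGMod.Hom.id M)⟩ : DGHot A) := by
  rw [IsZero.iff_id_eq_zero, mk_id, mk_zero, mk_eq_iff]
  let h : M × M →ₗ[(A : Type u)ᵐᵒᵖ] M × M :=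
    (LinearMap.inr _ M M).comp (LinearMap.fst _ M M)
  have hh : ∀ x, h x = (0, x.1) := fun _ => rfl
  refine ⟨h, fun i m hm => ⟨zero_mem _, ?_⟩, fun m => ?_⟩
  · have := hm.1
    simpa [hh] using this
  · ext <;> simp [hh]

theorem contractible_mem (X : DGHot A) : contractibleTriangle X ∈ distTriangles A := by
  refine ⟨X.as, X.as, DGMod.Hom.id X.as, ⟨Triangle.isoMk _ _ (Iso.refl _) (Iso.refl _)
    ((isZero_zero _).iso (isZero_cone_id X.as)) ?_ ?_ ?_⟩⟩
  · rfl
  · exact (isZero_cone_id X.as).eq_of_tgt _ _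
  · exact (isZero_zero _).eq_of_src _ _

/-- `{1}M` is homotopy equivalent to the cone of the inclusion `N → cone f`. -/
def rotIso {M N : DGMod A} (f : DGMod.Hom M N) :
    (⟨M.shift 1⟩ : DGHot A) ≅ ⟨DGMod.cone (DGMod.coneInl f)⟩ where
  hom := mk
    { lin := ((LinearMap.inr _ N M).prod (-f.lin) : M →ₗ[(A : Type u)ᵐᵒᵖ] (N × M) × N)
      map_mem := fun hm => ⟨⟨zero_mem _, hm⟩, (N.gr _).neg_mem (f.map_mem hm)⟩
      comm := fun m => by ext <;> simp [DGMod.coneInl, f.comm] }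
  inv := mk
    { lin := ((LinearMap.snd _ N M).comp (LinearMap.fst _ (N × M) N) :
        (N × M) × N →ₗ[(A : Type u)ᵐᵒᵖ] M)
      map_mem := fun hm => hm.1.2
      comm := fun m => by simp [DGMod.coneInl] }
  hom_inv_id := mk_eq_of_lin fun _ => rfl
  inv_hom_id := by
    symm
    rw [mk_id, mk_comp, mk_eq_iff]
    let h : (N × M) × N →ₗ[(A : Type u)ᵐᵒᵖ] (N × M) × N :=
      (LinearMap.inr _ (N × M) N).comp ((LinearMap.fst _ N M).comp (LinearMap.fst _ (N × M) N))
    have hh : ∀ x, h x = (0, x.1.1) := fun _ => rfl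
    refine ⟨h, fun i m hm => ⟨zero_mem _, ?_⟩, fun m => ?_⟩
    · have := hm.1.1
      simpa [hh] using this
    · rw [DGMod.Hom.lin_sub, LinearMap.sub_apply]
      obtain ⟨⟨n, m⟩, n'⟩ := m
      change (((n, m), n') : (N × M) × N) - ((0, m), -f.lin m) =
        ((N.d 0 + f.lin 0 + n, -M.d 0 + 0), -N.d n) + ((0, 0), N.d n + f.lin m + n')
      ext
      · simp
      · simp
      · simp only [Prod.snd_sub, Prod.snd_add]
        abel

theorem rotate_std {M N : DGMod A} (f : DGMod.Hom M N) :
    (stdTriangle f).rotate ∈ distTriangles A := by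
  refine ⟨N, DGMod.cone f, DGMod.coneInl f, ⟨Triangle.isoMk _ _ (Iso.refl _) (Iso.refl _)
    (rotIso f) ?_ ?_ ?_⟩⟩
  · rfl
  · exact (Iso.eq_comp_inv (rotIso f)).1
      (show mk (DGMod.coneSnd f) = mk (DGMod.coneInl (DGMod.coneInl f)) ≫ (rotIso f).inv from rfl)
  · exact mk_eq_of_lin fun _ => rfl

theorem shiftAdd'_inv_app (M : DGMod A) (a b c : ℤ) (h : a + b = c) :
    (shiftFunctorAdd' (DGHot A) a b c h).inv.app ⟨M⟩ =
      mk ((M.shiftAddInv a b).comp (M.shiftCast h)) := by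
  subst h
  rw [shiftFunctorAdd'_eq_shiftFunctorAdd]
  rfl

theorem shiftAdd'_hom_app (M : DGMod A) (a b c : ℤ) (h : a + b = c) :
    (shiftFunctorAdd' (DGHot A) a b c h).hom.app ⟨M⟩ =
      mk ((M.shiftCast h.symm).comp (M.shiftAdd a b)) := by
  subst h
  rw [shiftFunctorAdd'_eq_shiftFunctorAdd]
  rfl

theorem unit_inv_app (M : DGMod A) :
    (shiftEquiv (DGHot A) (1 : ℤ)).unitIso.inv.app ⟨M⟩ =
      mk ((M.shiftAddInv 1 (-1)).comp ((M.shiftCast (by norm_num)).comp M.shiftZero)) := by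
  have h := shiftAdd'_inv_app M 1 (-1) 0 (by norm_num)
  exact congrArg (fun g => g ≫ (shiftFunctorZero (DGHot A) ℤ).hom.app ⟨M⟩) h

theorem counit_inv_app (M : DGMod A) :
    (shiftEquiv (DGHot A) (1 : ℤ)).counitIso.inv.app ⟨M⟩ =
      mk (M.shiftZeroInv.comp ((M.shiftCast (by norm_num)).comp (M.shiftAdd (-1) 1))) := by
  have h := shiftAdd'_hom_app M (-1) 1 0 (by norm_num)
  exact congrArg (fun g => (shiftFunctorZero (DGHot A) ℤ).inv.app ⟨M⟩ ≫ g) h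

/-- A morphism of dg modules representing `{-1} cone f → M`, the shifted third map of the
standard triangle of `f`, up to sign. -/
def invRotMap {M N : DGMod A} (f : DGMod.Hom M N) :
    DGMod.Hom ((DGMod.cone f).shift (-1)) M where
  lin := (-(LinearMap.snd _ N M) : N × M →ₗ[(A : Type u)ᵐᵒᵖ] M)
  map_mem {i m} hm := by
    have := hm.2
    simpa using this
  comm m := by simp

/-- `N` is homotopy equivalent to the cone of `{-1} cone f → M`. -/
def invRotIso {M N : DGMod A} (f : DGMod.Hom M N) :
    (⟨N⟩ : DGHot A) ≅ ⟨DGMod.cone (invRotMap f)⟩ where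
  hom := mk
    { lin := ((LinearMap.inr _ M (N × M)).comp (LinearMap.inl _ N M) :
        N →ₗ[(A : Type u)ᵐᵒᵖ] M × (N × M))
      map_mem := fun {i m} hm => ⟨zero_mem _, by
        change m ∈ N.gr (i + 1 + -1)
        rwa [show i + 1 + -1 = i by ring], zero_mem _⟩
      comm := fun m => by ext <;> simp [invRotMap] }
  inv := mk
    { lin := ((LinearMap.fst _ N M).comp (LinearMap.snd _ M (N × M)) +
        f.lin.comp (LinearMap.fst _ M (N × M)) : M × (N × M) →ₗ[(A : Type u)ᵐᵒᵖ] N)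
      map_mem := fun {i m} hm => add_mem (by
        have : m.2.1 ∈ N.gr (i + 1 + -1) := hm.2.1
        rwa [show i + 1 + -1 = i by ring] at this) (f.map_mem hm.1)
      comm := fun m => by
        simp [invRotMap, f.comm]
        abel }
  hom_inv_id := mk_eq_of_lin fun x => by
    change x + f.lin 0 = x
    simp
  inv_hom_id := by
    symm
    rw [mk_id, mk_comp, mk_eq_iff]
    let h : M × (N × M) →ₗ[(A : Type u)ᵐᵒᵖ] M × (N × M) :=
      (LinearMap.inr _ M (N × M)).comp ((LinearMap.inr _ N M).comp (-(LinearMap.fst _ M (N × M))))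
    have hh : ∀ x, h x = (0, (0, -x.1)) := fun _ => rfl
    refine ⟨h, fun i m hm => ⟨zero_mem _, zero_mem _, ?_⟩, fun m => ?_⟩
    · have := hm.1
      simpa [hh] using this
    · rw [DGMod.Hom.lin_sub, LinearMap.sub_apply]
      obtain ⟨m', n, m⟩ := m
      change ((m', n, m) : M × (N × M)) - (0, n + f.lin m', 0) =
        (DGMod.cone (invRotMap f)).d (0, 0, -m') + (0, 0, -(M.d m' + -m))
      ext <;> simp [invRotMap]

theorem invRotate_std {M N : DGMod A} (f : DGMod.Hom M N) :
    (stdTriangle f).invRotate ∈ distTriangles A := by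
  refine ⟨(DGMod.cone f).shift (-1), M, invRotMap f, ⟨Triangle.isoMk _ _ (Iso.refl _) (Iso.refl _)
    (invRotIso f) ?_ ?_ ?_⟩⟩
  · change (-(shiftFunctor (DGHot A) (-1)).map (mk (DGMod.coneSnd f)) ≫
      (shiftEquiv (DGHot A) (1 : ℤ)).unitIso.inv.app ⟨M⟩) ≫ 𝟙 _ = 𝟙 _ ≫ mk (invRotMap f)
    rw [unit_inv_app, Category.comp_id, Category.id_comp]
    exact mk_eq_of_lin fun _ => rfl
  · exact (Iso.eq_comp_inv (invRotIso f)).1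
      (show mk f = mk (DGMod.coneInl (invRotMap f)) ≫ (invRotIso f).inv from
        mk_eq_of_lin fun x => (zero_add (f.lin x)).symm)
  · change (mk (DGMod.coneInl f) ≫
      (shiftEquiv (DGHot A) (1 : ℤ)).counitIso.inv.app ⟨DGMod.cone f⟩) ≫ _ = _
    rw [counit_inv_app]
    exact mk_eq_of_lin fun _ => rfl

theorem mem_of_iso {T T' : Triangle (DGHot A)} (e : T' ≅ T) (h : T ∈ distTriangles A) :
    T' ∈ distTriangles A := by
  obtain ⟨M, N, f, ⟨e'⟩⟩ := h
  exact ⟨M, N, f, ⟨e ≪≫ e'⟩⟩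

theorem rotate_mem_iff (T : Triangle (DGHot A)) :
    T ∈ distTriangles A ↔ T.rotate ∈ distTriangles A := by
  constructor
  · rintro ⟨M, N, f, ⟨e⟩⟩
    exact mem_of_iso ((rotate (DGHot A)).mapIso e) (rotate_std f)
  · rintro ⟨M, N, f, ⟨e⟩⟩
    exact mem_of_iso (rotCompInvRot.app T ≪≫ (invRotate (DGHot A)).mapIso e) (invRotate_std f)

theorem complete_of_iso {C : Type*} [Category* C] [HasShift C ℤ] {T T' S S' : Triangle C}
    (e : T ≅ S) (e' : T' ≅ S')
    (H : ∀ (a : S.obj₁ ⟶ S'.obj₁) (b : S.obj₂ ⟶ S'.obj₂), S.mor₁ ≫ b = a ≫ S'.mor₁ →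
      ∃ c : S.obj₃ ⟶ S'.obj₃, S.mor₂ ≫ c = b ≫ S'.mor₂ ∧
        S.mor₃ ≫ a⟦(1 : ℤ)⟧' = c ≫ S'.mor₃)
    (a : T.obj₁ ⟶ T'.obj₁) (b : T.obj₂ ⟶ T'.obj₂) (hab : T.mor₁ ≫ b = a ≫ T'.mor₁) :
    ∃ c : T.obj₃ ⟶ T'.obj₃, T.mor₂ ≫ c = b ≫ T'.mor₂ ∧
      T.mor₃ ≫ a⟦(1 : ℤ)⟧' = c ≫ T'.mor₃ := by
  obtain ⟨c, hc₁, hc₂⟩ := H (e.inv.hom₁ ≫ a ≫ e'.hom.hom₁) (e.inv.hom₂ ≫ b ≫ e'.hom.hom₂) (by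
    rw [e.inv.comm₁_assoc, reassoc_of% hab, e'.hom.comm₁, Category.assoc, Category.assoc])
  refine ⟨e.hom.hom₃ ≫ c ≫ e'.inv.hom₃, ?_, ?_⟩
  · rw [e.hom.comm₂_assoc, reassoc_of% hc₁, e'.inv.comm₂]
    simp
  · rw [Category.assoc, Category.assoc, ← e'.inv.comm₃, ← reassoc_of% hc₂, ← e.hom.comm₃_assoc,
      ← Functor.map_comp, ← Functor.map_comp]
    simp

theorem complete_std {M N M' N' : DGMod A} (f : DGMod.Hom M N) (f' : DGMod.Hom M' N')
    (a : (stdTriangle f).obj₁ ⟶ (stdTriangle f').obj₁)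
    (b : (stdTriangle f).obj₂ ⟶ (stdTriangle f').obj₂)
    (hab : (stdTriangle f).mor₁ ≫ b = a ≫ (stdTriangle f').mor₁) :
    ∃ c : (stdTriangle f).obj₃ ⟶ (stdTriangle f').obj₃,
      (stdTriangle f).mor₂ ≫ c = b ≫ (stdTriangle f').mor₂ ∧
      (stdTriangle f).mor₃ ≫ a⟦(1 : ℤ)⟧' = c ≫ (stdTriangle f').mor₃ := by
  obtain ⟨a, rfl⟩ := mk_surj a
  obtain ⟨b, rfl⟩ := mk_surj b
  change DGMod.Hom M M' at a
  change DGMod.Hom N N' at b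
  obtain ⟨s, hs₁, hs₂⟩ := (mk_eq_iff (f.comp b) (a.comp f')).1 hab
  let l : N × M →ₗ[(A : Type u)ᵐᵒᵖ] N' × M' :=
    (b.lin.comp (LinearMap.fst _ N M) + s.comp (LinearMap.snd _ N M)).prod
      (a.lin.comp (LinearMap.snd _ N M))
  have hl : ∀ x, l x = (b.lin x.1 + s x.2, a.lin x.2) := fun _ => rfl
  refine ⟨mk ⟨l, fun {i m} hm => ⟨add_mem (b.map_mem hm.1) ?_, a.map_mem hm.2⟩, fun m => ?_⟩,
    mk_eq_of_lin fun x => ?_, mk_eq_of_lin fun x => rfl⟩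
  · have := hs₁ _ _ hm.2
    simpa using this
  · have h := hs₂ m.2
    simp only [DGMod.Hom.lin_sub, DGMod.Hom.comp_lin, LinearMap.sub_apply,
      LinearMap.comp_apply] at h
    rw [hl, hl]
    ext
    · simp only [AddMonoidHom.prod_apply, AddMonoidHom.add_apply, AddMonoidHom.comp_apply,
        AddMonoidHom.coe_fst, AddMonoidHom.coe_snd, AddMonoidHom.neg_apply, map_add, map_neg,
        LinearMap.toAddMonoidHom_coe, b.comm]
      rw [sub_eq_iff_eq_add.1 h]
      abel
    · simp [a.comm]
  · change l (x, 0) = (b.lin x, 0)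
    simp [hl]

instance : Pretriangulated (DGHot A) where
  distinguishedTriangles := distTriangles A
  isomorphic_distinguished _ h _ e := mem_of_iso e h
  contractible_distinguished := contractible_mem
  distinguished_cocone_triangle {X Y} f := by
    obtain ⟨f, rfl⟩ := mk_surj f
    exact ⟨⟨DGMod.cone f⟩, mk (DGMod.coneInl f), mk (DGMod.coneSnd f), X.as, Y.as, f,
      ⟨Iso.refl _⟩⟩
  rotate_distinguished_triangle := rotate_mem_iff
  complete_distinguished_triangle_morphism := by
    rintro T T' ⟨M, N, f, ⟨e⟩⟩ ⟨M', N', f', ⟨e'⟩⟩ a b hab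
    exact complete_of_iso e e' (complete_std f f') a b hab

end DGHot

namespace DGMod

variable {A : DGAlgebra.{w, u} k}

/-- `A` as a dg module over itself. -/
def self (A : DGAlgebra.{w, u} k) : DGMod A where
  carrier := A
  gr i := (A.gr i).toAddSubgroup
  isInternal := DirectSum.Decomposition.isInternal A.gr
  smul_mem hm ha := SetLike.GradedMul.mul_mem (A := A.gr) hm ha
  d := A.d.toAddMonoidHom
  d_mem hm := A.d_mem hm
  d_d m := A.d_d m
  leibniz a hm := A.leibniz a hm

/-- The endomorphism of `M / S` induced by an additive endomorphism of `M` preserving `S`. -/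
def quotMap {M : DGMod A} (S : Submodule (A : Type u)ᵐᵒᵖ M) (φ : M →+ M)
    (h : ∀ x ∈ S, φ x ∈ S) : M ⧸ S →+ M ⧸ S :=
  QuotientAddGroup.map S.toAddSubgroup S.toAddSubgroup φ h

theorem quotMap_mkQ {M : DGMod A} (S : Submodule (A : Type u)ᵐᵒᵖ M) (φ : M →+ M)
    (h : ∀ x ∈ S, φ x ∈ S) (x : M) : quotMap S φ h (S.mkQ x) = S.mkQ (φ x) := rfl

/-- The quotient of a dg module `M` by a dg submodule, i.e. by a submodule that is graded and
stable under the differential. -/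
abbrev quot (M : DGMod A) (S : Submodule (A : Type u)ᵐᵒᵖ M)
    (hS : ∀ (i : ℤ), ∀ x ∈ S, M.proj i x ∈ S) (hd : ∀ x ∈ S, M.d x ∈ S) : DGMod A where
  carrier := M ⧸ S
  gr i := (M.gr i).map S.mkQ.toAddMonoidHom
  isInternal := isInternal_of_proj _ (fun i => quotMap S (M.proj i) (hS i))
    (by
      rintro i _ ⟨x, hx, rfl⟩
      exact congrArg S.mkQ (M.proj_same i x hx))
    (by
      rintro i j h _ ⟨x, hx, rfl⟩
      exact (congrArg S.mkQ (M.proj_ne i j h x hx)).trans (map_zero _))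
    (fun x => by
      obtain ⟨x, rfl⟩ := S.mkQ_surjective x
      have h := AddSubgroup.mem_map_of_mem S.mkQ.toAddMonoidHom (M.mem_iSup x)
      rwa [AddSubgroup.map_iSup] at h)
  smul_mem := by
    rintro i j _ a ⟨x, hx, rfl⟩ ha
    exact ⟨op a • x, M.smul_mem hx ha, rfl⟩
  d := quotMap S M.d hd
  d_mem := by
    rintro i _ ⟨x, hx, rfl⟩
    exact ⟨M.d x, M.d_mem hx, rfl⟩
  d_d x := by
    obtain ⟨x, rfl⟩ := S.mkQ_surjective x
    exact (congrArg S.mkQ (M.d_d x)).trans (map_zero _)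
  leibniz := by
    rintro i _ a ⟨x, hx, rfl⟩
    exact (congrArg S.mkQ (M.leibniz a hx)).trans (by
      rw [map_add]
      congr 1)

theorem hom_induction (M : DGMod A) {motive : M → Prop} (zero : motive 0)
    (mem : ∀ (i : ℤ), ∀ x ∈ M.gr i, motive x)
    (add : ∀ x y, motive x → motive y → motive (x + y)) (x : M) : motive x := by
  let _ := M.isInternal.chooseDecomposition
  exact DirectSum.Decomposition.inductionOn M.gr zero (fun y => mem _ _ y.2) add x

/-- The subset `M A^+` of `M`, where `A^+ = ⨁_{i > 0} A^i`: the subgroup generated by the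
products `m · a` with `a` homogeneous of positive degree. -/
def mulPosGrp (M : DGMod A) : AddSubgroup M :=
  AddSubgroup.closure {x : M | ∃ (m : M) (j : ℤ) (a : A), 0 < j ∧ a ∈ A.gr j ∧ x = op a • m}

theorem smul_mem_mulPosGrp (M : DGMod A) {j : ℤ} (hj : 0 < j) {a : A} (ha : a ∈ A.gr j) (m : M) :
    op a • m ∈ M.mulPosGrp :=
  AddSubgroup.subset_closure ⟨m, j, a, hj, ha, rfl⟩

theorem map_mem_mulPosGrp (M : DGMod A) (φ : M →+ M)
    (h : ∀ (i j : ℤ) (m : M) (a : A), 0 < j → m ∈ M.gr i → a ∈ A.gr j →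
      φ (op a • m) ∈ M.mulPosGrp) (x : M) (hx : x ∈ M.mulPosGrp) : φ x ∈ M.mulPosGrp := by
  have : M.mulPosGrp ≤ M.mulPosGrp.comap φ := by
    refine (AddSubgroup.closure_le _).2 ?_
    rintro _ ⟨m, j, a, hj, ha, rfl⟩
    change φ (op a • m) ∈ M.mulPosGrp
    refine M.hom_induction (motive := fun m => φ (op a • m) ∈ M.mulPosGrp) ?_
      (fun i m hm => h i j m a hj hm ha) (fun x y hx hy => ?_) m
    · simp [zero_mem]
    · rw [smul_add, map_add]
      exact add_mem hx hy
  exact this hx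

/-- `M A^+` is a submodule of `M` if `A` is positively graded. -/
def mulPos (hA : A.IsPositive) (M : DGMod A) : Submodule (A : Type u)ᵐᵒᵖ M where
  carrier := M.mulPosGrp
  add_mem' := add_mem
  zero_mem' := zero_mem _
  smul_mem' c x hx := by
    refine M.map_mem_mulPosGrp (DistribSMul.toAddMonoidHom M c) (fun i j m a hj hm ha => ?_) x hx
    change c • op a • m ∈ M.mulPosGrp
    obtain ⟨c, rfl⟩ := MulOpposite.op_surjective c
    refine DirectSum.Decomposition.inductionOn A.gr
      (motive := fun c : A => op c • op a • m ∈ M.mulPosGrp) ?_ (fun {l} c => ?_)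
      (fun x y hx hy => ?_) c
    · simp [zero_mem]
    · by_cases hl : l < 0
      · have hc : (c : A) = 0 := (Submodule.mem_bot k).1 ((hA l hl).le c.2)
        simp [hc, zero_mem]
      · rw [smul_smul, ← MulOpposite.op_mul]
        exact M.smul_mem_mulPosGrp (by omega)
          (SetLike.GradedMul.mul_mem (A := A.gr) ha c.2 : a * c ∈ A.gr (j + l)) m
    · rw [MulOpposite.op_add, add_smul]
      exact add_mem hx hy

/-- The dg module `M̄ = M / M A^+ = M ⊗_A A^0`. It is a dg module over `A^0 = A / A^+`, and we
view it as a dg module over `A` along the projection `A → A^0`. -/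
def bar (hA : A.IsPositive) (M : DGMod A) : DGMod A :=
  M.quot (M.mulPos hA)
    (fun i => M.map_mem_mulPosGrp (M.proj i) (fun i' j m a hj hm ha => by
      by_cases h : i = i' + j
      · rw [M.proj_same _ _ (h ▸ M.smul_mem hm ha)]
        exact M.smul_mem_mulPosGrp hj ha m
      · rw [M.proj_ne _ _ h _ (M.smul_mem hm ha)]
        exact zero_mem _))
    (M.map_mem_mulPosGrp M.d (fun i j m a hj hm ha => by
      rw [M.leibniz a hm]
      have h := M.smul_mem_mulPosGrp (show 0 < j + 1 by omega) (A.d_mem ha) m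
      refine add_mem (M.smul_mem_mulPosGrp hj ha _) ?_
      rcases Int.units_eq_one_or i.negOnePow with h' | h' <;> simpa [h'] using h))

/-- The group of `i`-cocycles. -/
def cocycles (M : DGMod A) (i : ℤ) : AddSubgroup M := M.d.ker ⊓ M.gr i

/-- The group of `i`-coboundaries. -/
def coboundaries (M : DGMod A) (i : ℤ) : AddSubgroup M := (M.gr (i - 1)).map M.d

/-- The cohomology `H^i(M)`. -/
def cohomology (M : DGMod A) (i : ℤ) : Type u :=
  M.cocycles i ⧸ (M.coboundaries i).addSubgroupOf (M.cocycles i)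

/-- The support `{i ∈ ℤ | H^i(M) ≠ 0}` of the cohomology of `M`. -/
def suppH (M : DGMod A) : Set ℤ := {i | Nontrivial (M.cohomology i)}

section ExtensionOfScalars

variable (L : Type u) [AddCommGroup L]

/-- The component of degree `i` of `L ⊗_ℤ A`, with `L` in degree zero. -/
def tensGr (A : DGAlgebra.{w, u} k) (i : ℤ) : AddSubgroup ((A : Type u) ⊗[ℤ] L) :=
  AddSubgroup.closure {x | ∃ a ∈ A.gr i, ∃ l : L, x = a ⊗ₜ[ℤ] l}

/-- The projection of `L ⊗_ℤ A` onto the component of degree `i`. -/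
def tensProj (A : DGAlgebra.{w, u} k) (i : ℤ) :
    (A : Type u) ⊗[ℤ] L →+ (A : Type u) ⊗[ℤ] L :=
  (LinearMap.rTensor L (GradedRing.proj A.gr i).toIntLinearMap).toAddMonoidHom

theorem tensProj_same (A : DGAlgebra.{w, u} k) (i : ℤ) (x : (A : Type u) ⊗[ℤ] L)
    (hx : x ∈ tensGr L A i) : tensProj L A i x = x := by
  induction hx using AddSubgroup.closure_induction with
  | zero => rw [map_zero]
  | neg x _ h => rw [map_neg, h]
  | add x y _ _ hx hy => rw [map_add, hx, hy]
  | mem x h =>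
    obtain ⟨a, ha, l, rfl⟩ := h
    exact congrArg (· ⊗ₜ[ℤ] l) (DirectSum.decompose_of_mem_same A.gr ha)

theorem tensProj_ne (A : DGAlgebra.{w, u} k) (i j : ℤ) (h : i ≠ j) (x : (A : Type u) ⊗[ℤ] L)
    (hx : x ∈ tensGr L A j) : tensProj L A i x = 0 := by
  induction hx using AddSubgroup.closure_induction with
  | zero => rw [map_zero]
  | neg x _ h => rw [map_neg, h, neg_zero]
  | add x y _ _ hx hy => rw [map_add, hx, hy, add_zero]
  | mem x h' =>
    obtain ⟨a, ha, l, rfl⟩ := h'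
    exact (congrArg (· ⊗ₜ[ℤ] l) (DirectSum.decompose_of_mem_ne A.gr ha h.symm)).trans
      (TensorProduct.zero_tmul _ _)

theorem mem_iSup_tensGr (A : DGAlgebra.{w, u} k) (x : (A : Type u) ⊗[ℤ] L) :
    x ∈ ⨆ i, tensGr L A i := by
  induction x using TensorProduct.induction_on with
  | zero => exact zero_mem _
  | add x y hx hy => exact add_mem hx hy
  | tmul a l =>
    refine DirectSum.Decomposition.inductionOn A.gr
      (motive := fun a : A => a ⊗ₜ[ℤ] l ∈ ⨆ i, tensGr L A i) ?_ (fun {i} a => ?_)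
      (fun a b ha hb => ?_) a
    · rw [TensorProduct.zero_tmul]
      exact zero_mem _
    · exact (le_iSup (tensGr L A) i) (AddSubgroup.subset_closure ⟨a, a.2, l, rfl⟩)
    · rw [TensorProduct.add_tmul]
      exact add_mem ha hb

/-- The dg module `L ⊗_ℤ A`, with `L` in degree zero and differential `id ⊗ d`. The factors are
written in the opposite order, since right multiplication by `A` acts on the factor `A`. -/
abbrev tens (A : DGAlgebra.{w, u} k) : DGMod A where
  carrier := (A : Type u) ⊗[ℤ] L
  gr i := tensGr L A i
  isInternal := isInternal_of_proj _ (tensProj L A) (tensProj_same L A) (tensProj_ne L A)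
    (mem_iSup_tensGr L A)
  smul_mem {i j x b} hx hb := by
    induction hx using AddSubgroup.closure_induction with
    | zero => rw [smul_zero]; exact zero_mem _
    | neg x _ h => rw [smul_neg]; exact neg_mem h
    | add x y _ _ hx hy => rw [smul_add]; exact add_mem hx hy
    | mem x h =>
      obtain ⟨a, ha, l, rfl⟩ := h
      exact AddSubgroup.subset_closure
        ⟨a * b, SetLike.GradedMul.mul_mem (A := A.gr) ha hb, l, rfl⟩
  d := (LinearMap.rTensor L A.d.toAddMonoidHom.toIntLinearMap).toAddMonoidHom
  d_mem {i x} hx := by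
    induction hx using AddSubgroup.closure_induction with
    | zero => rw [map_zero]; exact zero_mem _
    | neg x _ h => rw [map_neg]; exact neg_mem h
    | add x y _ _ hx hy => rw [map_add]; exact add_mem hx hy
    | mem x h =>
      obtain ⟨a, ha, l, rfl⟩ := h
      exact AddSubgroup.subset_closure ⟨A.d a, A.d_mem ha, l, rfl⟩
  d_d x := by
    induction x using TensorProduct.induction_on with
    | zero => simp
    | add x y hx hy => rw [map_add, map_add, hx, hy, add_zero]
    | tmul a l => exact (congrArg (· ⊗ₜ[ℤ] l) (A.d_d a)).trans (TensorProduct.zero_tmul _ _)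
  leibniz {i x} b hx := by
    induction hx using AddSubgroup.closure_induction with
    | zero => simp
    | neg x _ h => simp only [smul_neg, map_neg, h, neg_add]
    | add x y _ _ hx hy =>
      simp only [smul_add, map_add, hx, hy]
      abel
    | mem x h =>
      obtain ⟨a, ha, l, rfl⟩ := h
      refine (congrArg (· ⊗ₜ[ℤ] l) (A.leibniz b ha)).trans ?_
      change (A.d a * b + i.negOnePow • (a * A.d b)) ⊗ₜ[ℤ] l =
        (A.d a * b) ⊗ₜ[ℤ] l + i.negOnePow • ((a * A.d b) ⊗ₜ[ℤ] l)
      rw [TensorProduct.add_tmul]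
      rcases Int.units_eq_one_or i.negOnePow with h | h <;> simp [h, TensorProduct.neg_tmul]

variable [Module (A.gr 0)ᵐᵒᵖ L]

/-- The subgroup of `L ⊗_ℤ A` generated by the elements `l ⊗ a₀ a - l a₀ ⊗ a` with `a₀ ∈ A^0`. -/
def relGrp (A : DGAlgebra.{w, u} k) [Module (A.gr 0)ᵐᵒᵖ L] : AddSubgroup (tens L A) :=
  AddSubgroup.closure {x | ∃ (a₀ : A.gr 0) (a : A) (l : L),
    x = ((a₀ : A) * a) ⊗ₜ[ℤ] l - a ⊗ₜ[ℤ] (op a₀ • l)}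

theorem map_mem_relGrp (φ : A →+ A)
    (h : ∀ (a₀ : A.gr 0) (a : A), φ ((a₀ : A) * a) = (a₀ : A) * φ a) (x : tens L A)
    (hx : x ∈ relGrp L A) :
    LinearMap.rTensor L φ.toIntLinearMap x ∈ relGrp L A := by
  induction hx using AddSubgroup.closure_induction with
  | zero => rw [map_zero]; exact zero_mem _
  | neg x _ h => rw [map_neg]; exact neg_mem h
  | add x y _ _ hx hy => rw [map_add]; exact add_mem hx hy
  | mem x hx =>
    obtain ⟨a₀, a, l, rfl⟩ := hx
    refine AddSubgroup.subset_closure ⟨a₀, φ a, l, ?_⟩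
    rw [map_sub, ← h]
    rfl

/-- The same subgroup as a submodule. -/
def rel (A : DGAlgebra.{w, u} k) [Module (A.gr 0)ᵐᵒᵖ L] :
    Submodule (A : Type u)ᵐᵒᵖ (tens L A) where
  carrier := relGrp L A
  add_mem' := add_mem
  zero_mem' := zero_mem _
  smul_mem' c x hx := by
    have h := map_mem_relGrp L (DistribSMul.toAddMonoidHom (A : Type u) c)
      (fun a₀ a => (mul_smul_comm c (a₀ : A) a).symm ▸ rfl) x hx
    have : LinearMap.rTensor L (DistribSMul.toAddMonoidHom (A : Type u) c).toIntLinearMap x =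
        c • x := by
      clear h hx
      induction x using TensorProduct.induction_on with
      | zero => simp
      | add x y hx hy => rw [map_add, hx, hy, smul_add]
      | tmul a l => rfl
    exact this ▸ h

/-- The dg module `L̂ = L ⊗_{A^0} A` for a right `A^0`-module `L` (viewed as a dg module over
`A^0` in degree zero), where the differential of `A` vanishes on `A^0`. Its differential is
`l ⊗ a ↦ l ⊗ d a`, and `l ⊗ a` has the degree of `a`. -/
def hat (hA : A.ZeroDiff) : DGMod A :=
  (tens L A).quot (rel L A)
    (fun i x hx => by
      have h : (tens L A).proj i x = tensProj L A i x := by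
        refine (tens L A).hom_induction (motive := fun x => (tens L A).proj i x = tensProj L A i x)
          ?_ (fun j x hx => ?_) (fun x y hx hy => ?_) x
        · rw [map_zero, map_zero]
        · by_cases h : i = j
          · subst h
            rw [proj_same _ _ _ hx, tensProj_same L A _ _ hx]
          · rw [proj_ne _ _ _ h _ hx, tensProj_ne L A _ _ h _ hx]
        · rw [map_add, map_add, hx, hy]
      rw [h]
      exact map_mem_relGrp L (GradedRing.proj A.gr i) (fun a₀ a =>
        DirectSum.coe_decompose_mul_of_left_mem_zero A.gr a₀.2) x hx)
    (fun x hx => map_mem_relGrp L A.d.toAddMonoidHom (fun a₀ a => by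
      have h := A.leibniz a a₀.2
      rw [hA _ a₀.2] at h
      simpa using h) x hx)

end ExtensionOfScalars

end DGMod

namespace DGHot

variable (A : DGAlgebra.{w, u} k)

/-- `dgPer(A)`, the perfect dg modules: the smallest full triangulated subcategory of `dgHot(A)`
that contains `A` and is closed under direct summands (that is, under retracts). -/
def dgPer : ObjectProperty (DGHot A) := fun X =>
  ∀ P : ObjectProperty (DGHot A), P.IsTriangulated → P.IsStableUnderRetracts →
    P ⟨DGMod.self A⟩ → P X

instance : (dgPer A).IsStableUnderRetracts where
  of_retract r h P hP hR hA := P.prop_of_retract r (h P hP hR hA)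

instance : (dgPer A).IsTriangulated where
  exists_zero := by
    obtain ⟨Z, hZ⟩ := HasZeroObject.zero (C := DGHot A)
    exact ⟨Z, hZ, fun P hP hR _ => P.prop_of_isZero hZ⟩
  isStableUnderShiftBy n := ⟨fun X h P hP hR hA => P.le_shift n X (h P hP hR hA)⟩
  ext₂' T hT h₁ h₃ := ObjectProperty.le_isoClosure _ _ fun P hP hR hA =>
    P.ext_of_isTriangulatedClosed₂ T hT (h₁ P hP hR hA) (h₃ P hP hR hA)

variable {A}

/-- `dgPrae(A)`: the smallest strict (i.e. closed under isomorphisms) full triangulated subcategory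
of `dgHot(A)` that contains `L̂` for all simple right `A^0`-modules `L`. -/
def dgPrae (hA : A.ZeroDiff) : ObjectProperty (DGHot A) := fun X =>
  ∀ P : ObjectProperty (DGHot A), P.IsTriangulated → P.IsClosedUnderIsomorphisms →
    (∀ (L : Type u) [AddCommGroup L] [Module (A.gr 0)ᵐᵒᵖ L] [IsSimpleModule (A.gr 0)ᵐᵒᵖ L],
      P ⟨DGMod.hat L hA⟩) → P X

/-- `dgPer^I(A)`, for `I ⊆ ℤ`: the full subcategory of `dgPer(A)` of all objects `M` such that
the support of `H(M̄) = H(M ⊗_A A^0)` is contained in `I`. -/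
def dgPerSupp (hA : A.IsPositive) (I : Set ℤ) : ObjectProperty (dgPer A).FullSubcategory :=
  fun X => (X.obj.as.bar hA).suppH ⊆ I

end DGHot

/-- A t-structure is bounded if every object is bounded above and below. -/
def IsBoundedTStructure {C : Type*} [Category* C] [Preadditive C] [HasZeroObject C]
    [HasShift C ℤ] [∀ n : ℤ, (shiftFunctor C n).Additive] [Pretriangulated C]
    (t : Triangulated.TStructure C) : Prop :=
  ∀ X : C, ∃ a b : ℤ, t.ge a X ∧ t.le b X

/-- A t-structure is non-degenerate if the objects that lie in `C^{≤ n}` for all `n` are zero,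
and so are the objects that lie in `C^{≥ n}` for all `n`. -/
def IsNondegenerateTStructure {C : Type*} [Category* C] [Preadditive C] [HasZeroObject C]
    [HasShift C ℤ] [∀ n : ℤ, (shiftFunctor C n).Additive] [Pretriangulated C]
    (t : Triangulated.TStructure C) : Prop :=
  (∀ X : C, (∀ n : ℤ, t.le n X) → IsZero X) ∧ (∀ X : C, (∀ n : ℤ, t.ge n X) → IsZero X)

end

/-!
The dg modules `L̂`, for `L` simple, behave like the simple objects of a heart: positivity of `A`
forces `Hom(L̂₁, L̂₂[n]) = 0` for `n < 0`, and `L ↦ L̂` is full, so that Schur's lemma applies.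
Every object of the triangulated subcategory they generate is an iterated extension of shifts
`L̂[-a]`. Adjacent factors in the wrong order can be interchanged or cancelled against each other,
because a nonzero map between factors of the same degree is an isomorphism; hence the factors can
be sorted by degree. Cutting a sorted extension gives the truncation triangles, and induction on
its length gives closure under direct summands. As `H^i` of `M/MA^+` is nonzero on `L̂[-a]` only
for `i = a`, it detects which degrees occur. Finally `A`, being `L̂` for `L = A^0`, is a finite sum
of dg modules `L̂`, and each `L̂` is a direct summand of `A`, so both generated subcategories agree.
-/

noncomputable section

variable {k : Type w} [CommRing k]

/-! ### Octahedra in `dgHot(A)` -/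

namespace DGHot

variable {A : DGAlgebra.{w, u} k} {M N P : DGMod A}

/-- The morphism `cone f → cone (g ∘ f)` induced by `g`. -/
def coneMapRight (f : DGMod.Hom M N) (g : DGMod.Hom N P) :
    DGMod.Hom (DGMod.cone f) (DGMod.cone (f.comp g)) where
  lin := (g.lin.comp (LinearMap.fst _ N M)).prod (LinearMap.snd _ N M)
  map_mem hx := ⟨g.map_mem hx.1, hx.2⟩
  comm x := by ext <;> simp [g.comm]

/-- The morphism `cone (g ∘ f) → cone g` induced by `f`. -/
def coneMapLeft (f : DGMod.Hom M N) (g : DGMod.Hom N P) :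
    DGMod.Hom (DGMod.cone (f.comp g)) (DGMod.cone g) where
  lin := (LinearMap.fst _ P M).prod (f.lin.comp (LinearMap.snd _ P M))
  map_mem hx := ⟨hx.1, f.map_mem hx.2⟩
  comm x := by ext <;> simp [f.comm]

/-- The inclusion of `cone g` into the cone of `coneMapRight f g : cone f → cone (g ∘ f)`. -/
def octahedronInl (f : DGMod.Hom M N) (g : DGMod.Hom N P) :
    DGMod.Hom (DGMod.cone g) (DGMod.cone (coneMapRight f g)) where
  lin := ((LinearMap.inl _ P M).comp (LinearMap.fst _ P N)).prod
    ((LinearMap.inl _ N M).comp (LinearMap.snd _ P N))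
  map_mem hx := ⟨⟨hx.1, zero_mem _⟩, ⟨hx.2, zero_mem _⟩⟩
  comm x := by ext <;> simp [coneMapRight]

/-- The retraction of `octahedronInl`. Its kernel is the cone of the identity of `M{1}`, so that it
is a homotopy inverse. -/
def octahedronRetraction (f : DGMod.Hom M N) (g : DGMod.Hom N P) :
    DGMod.Hom (DGMod.cone (coneMapRight f g)) (DGMod.cone g) where
  lin := (((LinearMap.fst _ P M).comp (LinearMap.fst _ (P × M) (N × M))).prod
    ((LinearMap.fst (A : Type u)ᵐᵒᵖ N M).comp (LinearMap.snd _ (P × M) (N × M)) +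
      f.lin.comp ((LinearMap.snd _ P M).comp (LinearMap.fst _ (P × M) (N × M)))) :
    (P × M) × (N × M) →ₗ[(A : Type u)ᵐᵒᵖ] P × N)
  map_mem hx := ⟨hx.1.1, (N.gr _).add_mem hx.2.1 (f.map_mem hx.1.2)⟩
  comm x := by
    ext
    · simp [coneMapRight]
      abel
    · simp [coneMapRight, f.comm]
      abel

theorem mk_octahedronRetraction_comp_mk_octahedronInl
    (f : DGMod.Hom M N) (g : DGMod.Hom N P) :
    mk (octahedronRetraction f g) ≫ mk (octahedronInl f g) = 𝟙 _ := by
  rw [eq_comm, mk_id, mk_comp, mk_eq_iff]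
  let h : (P × M) × (N × M) →ₗ[(A : Type u)ᵐᵒᵖ] (P × M) × (N × M) :=
    (LinearMap.inr _ (P × M) (N × M)).comp ((LinearMap.inr _ N M).comp
      ((LinearMap.snd _ P M).comp (LinearMap.fst _ (P × M) (N × M))))
  have h_apply : ∀ x, h x = ((0, 0), (0, x.1.2)) := fun _ => rfl
  refine ⟨h, fun i x hx => ⟨⟨zero_mem _, zero_mem _⟩, ⟨zero_mem _, ?_⟩⟩, fun x => ?_⟩
  · simpa [h_apply] using hx.1.2
  · rw [DGMod.Hom.lin_sub, LinearMap.sub_apply]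
    obtain ⟨⟨p, m⟩, n, m'⟩ := x
    change (((p, m), (n, m')) : (P × M) × (N × M)) - ((p, 0), (n + f.lin m, 0)) =
      (DGMod.cone (coneMapRight f g)).d ((0, 0), (0, m)) + ((0, 0), (0, -M.d m + m'))
    ext <;> simp [coneMapRight]

/-- `cone g` is homotopy equivalent to the cone of `cone f → cone (g ∘ f)`. -/
def octahedronIso (f : DGMod.Hom M N) (g : DGMod.Hom N P) :
    (⟨DGMod.cone g⟩ : DGHot A) ≅ ⟨DGMod.cone (coneMapRight f g)⟩ where
  hom := mk (octahedronInl f g)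
  inv := mk (octahedronRetraction f g)
  hom_inv_id := mk_eq_of_lin fun x => by
    change ((x.1, x.2 + f.lin 0) : P × N) = x
    simp only [map_zero, add_zero, Prod.mk.eta]
  inv_hom_id := mk_octahedronRetraction_comp_mk_octahedronInl f g

theorem mk_coneMapLeft_comp_octahedronIso_hom (f : DGMod.Hom M N) (g : DGMod.Hom N P) :
    mk (coneMapLeft f g) ≫ (octahedronIso f g).hom = mk (DGMod.coneInl (coneMapRight f g)) :=
  (Iso.eq_comp_inv (octahedronIso f g)).1 (mk_eq_of_lin fun x => by
    change ((x.1, f.lin x.2) : P × N) = (x.1, 0 + f.lin x.2)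
    rw [zero_add])

instance : IsTriangulated (DGHot A) := IsTriangulated.mk' (by
  intro X₁ X₂ X₃ u₁₂ u₂₃
  obtain ⟨f, rfl⟩ := mk_surj u₁₂
  obtain ⟨g, rfl⟩ := mk_surj u₂₃
  refine ⟨X₁, X₂, X₃, ⟨DGMod.cone f⟩, ⟨DGMod.cone g⟩, ⟨DGMod.cone (f.comp g)⟩, mk f, mk g,
    Iso.refl _, Iso.refl _, Iso.refl _, by rfl, by rfl,
    mk (DGMod.coneInl f), mk (DGMod.coneSnd f), ⟨X₁.as, X₂.as, f, ⟨Iso.refl _⟩⟩,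
    mk (DGMod.coneInl g), mk (DGMod.coneSnd g), ⟨X₂.as, X₃.as, g, ⟨Iso.refl _⟩⟩,
    mk (DGMod.coneInl (f.comp g)), mk (DGMod.coneSnd (f.comp g)),
    ⟨X₁.as, X₃.as, f.comp g, ⟨Iso.refl _⟩⟩, ⟨⟨mk (coneMapRight f g), mk (coneMapLeft f g),
      mk_eq_of_lin fun _ => rfl, mk_eq_of_lin fun _ => rfl, mk_eq_of_lin fun x => ?_,
      mk_eq_of_lin fun _ => rfl, ?_⟩⟩⟩
  · change ((x, f.lin 0) : X₃.as × X₂.as) = (x, 0)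
    rw [map_zero]
  · exact ⟨_, _, coneMapRight f g, ⟨Triangle.isoMk _ _ (Iso.refl _) (Iso.refl _)
      (octahedronIso f g) rfl
      ((mk_coneMapLeft_comp_octahedronIso_hom f g).trans (Category.id_comp _).symm)
      (mk_eq_of_lin fun _ => rfl)⟩⟩)

end DGHot

/-! ### Iterated extensions of shifts of a simple-minded class -/

section

variable {C : Type*} [Category* C] [HasShift C ℤ]

theorem prop_shift_shift_iff (P : ObjectProperty C) [P.IsClosedUnderIsomorphisms] (a b : ℤ)
    (X : C) : P.shift a (X⟦b⟧) ↔ P.shift (b + a) X := by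
  rw [← P.shift_shift b a (b + a) rfl, ObjectProperty.prop_shift_iff (P.shift a)]

/-- The class `Z` behaves like the vanishing of a cohomological functor `H` for which `H (X⟦n⟧)`
vanishes for all `X` in `P` and `n ≠ 0`, and which detects the zero objects of `P`. -/
structure IsDetectedBy (P Z : ObjectProperty C) : Prop where
  le_shift {n : ℤ} (hn : n ≠ 0) : P ≤ Z.shift n
  isZero {X : C} (hX : P X) (h : Z X) : IsZero X

theorem IsDetectedBy.shift_le {P Z : ObjectProperty C} [Z.IsClosedUnderIsomorphisms]
    (hZ : IsDetectedBy P Z) {a i : ℤ} (hi : a ≠ i) : P.shift a ≤ Z.shift i := fun X hX => by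
  have h := (prop_shift_shift_iff Z (i - a) a X).1 (hZ.le_shift (sub_ne_zero.2 hi.symm) _ hX)
  rwa [add_sub_cancel] at h

variable [Preadditive C]

/-- A class of objects without negative self-extensions in which, moreover, Schur's lemma holds:
all nonzero morphisms are invertible. Zero objects are included in the class. -/
class IsSimpleMinded (P : ObjectProperty C) : Prop
    extends P.IsClosedUnderIsomorphisms, P.ContainsZero where
  hom_eq_zero {X Y : C} {n : ℤ} (hn : n < 0) (hX : P X) (hY : P Y) (f : X ⟶ Y⟦n⟧) : f = 0
  isIso {X Y : C} (hX : P X) (hY : P Y) (f : X ⟶ Y) (hf : f ≠ 0) : IsIso f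

variable [∀ n : ℤ, (shiftFunctor C n).Additive] (P : ObjectProperty C)

instance shift_containsZero [P.ContainsZero] [P.IsClosedUnderIsomorphisms] [HasZeroObject C]
    (a : ℤ) : (P.shift a).ContainsZero :=
  ⟨_, isZero_zero C, P.prop_of_isZero ((shiftFunctor C a).map_isZero (isZero_zero C))⟩

variable {P}

theorem hom_eq_zero_of_shift [IsSimpleMinded P] {X Y : C} {a b : ℤ} (hab : a < b)
    (hX : P.shift a X) (hY : P.shift b Y) (f : X ⟶ Y) : f = 0 := by
  let e : Y⟦a⟧ ≅ Y⟦b⟧⟦a - b⟧ := (shiftFunctorAdd' C b (a - b) a (add_sub_cancel b a)).app Y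
  have hf : f⟦a⟧' ≫ e.hom = 0 := IsSimpleMinded.hom_eq_zero (P := P) (sub_neg.2 hab) hX hY _
  exact (shiftFunctor C a).map_injective <| by
    rwa [Functor.map_zero, ← cancel_mono e.hom, zero_comp]

theorem isIso_of_shift [IsSimpleMinded P] {X Y : C} {a : ℤ} (hX : P.shift a X)
    (hY : P.shift a Y) (f : X ⟶ Y) (hf : f ≠ 0) : IsIso f := by
  have : IsIso (f⟦a⟧') := IsSimpleMinded.isIso (P := P) hX hY _ fun h =>
    hf ((shiftFunctor C a).map_injective (h.trans (Functor.map_zero _ _ _).symm))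
  exact isIso_of_reflects_iso f (shiftFunctor C a)

variable [HasZeroObject C] [Pretriangulated C]

variable (P) in
/-- The iterated extensions `P[-a₁] * ⋯ * P[-aₙ]`, where `P[-a]` consists of the objects `X` with
`P (X⟦a⟧)`. -/
def extensionWord : List ℤ → ObjectProperty C
  | [] => IsZero
  | a :: l => (P.shift a).extensionProduct (extensionWord l)

variable (P) in
/-- The iterated extensions of objects of the classes `P[-a]`, `a ∈ I`. -/
def extensionHull (I : Set ℤ) : ObjectProperty C :=
  fun X => ∃ l : List ℤ, (∀ a ∈ l, a ∈ I) ∧ extensionWord P l X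

instance extensionWord_isClosedUnderIsomorphisms (l : List ℤ) :
    (extensionWord P l).IsClosedUnderIsomorphisms := by
  cases l with
  | nil => exact ⟨fun e h => h.of_iso e.symm⟩
  | cons a l => exact inferInstanceAs
      ((P.shift a).extensionProduct (extensionWord P l)).IsClosedUnderIsomorphisms

instance extensionHull_isClosedUnderIsomorphisms (I : Set ℤ) :
    (extensionHull P I).IsClosedUnderIsomorphisms :=
  ⟨fun e ⟨l, hl, h⟩ => ⟨l, hl, (extensionWord P l).prop_of_iso e h⟩⟩

instance extensionHull_containsZero (I : Set ℤ) : (extensionHull P I).ContainsZero :=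
  ⟨_, isZero_zero C, [], by simp, isZero_zero C⟩

theorem extensionHull_mono {I J : Set ℤ} (h : I ⊆ J) : extensionHull P I ≤ extensionHull P J :=
  fun _ ⟨l, hl, hX⟩ => ⟨l, fun a ha => h (hl a ha), hX⟩

theorem extensionHull_le {I : Set ℤ} {Q : ObjectProperty C} [Q.IsClosedUnderIsomorphisms]
    [Q.ContainsZero] [Q.IsTriangulatedClosed₂] (h : ∀ a ∈ I, P.shift a ≤ Q) :
    extensionHull P I ≤ Q := by
  rintro X ⟨l, hl, hX⟩
  induction l generalizing X with
  | nil => exact Q.prop_of_isZero hX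
  | cons a l ih =>
    rw [List.forall_mem_cons] at hl
    exact ObjectProperty.extensionProduct_le_of_isTriangulatedClosed₂ (h a hl.1)
      (fun Y => ih Y hl.2) X hX

theorem extensionHull_le_of_isTriangulated {I : Set ℤ} {Q : ObjectProperty C} [Q.IsTriangulated]
    [Q.IsClosedUnderIsomorphisms] (h : P ≤ Q) : extensionHull P I ≤ Q :=
  extensionHull_le fun a _ _ hX => (Q.prop_shift_iff_of_isStableUnderShift _ a).1 (h _ hX)

theorem isZero_extensionProduct (Q : ObjectProperty C) [Q.IsClosedUnderIsomorphisms] :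
    ObjectProperty.extensionProduct IsZero Q = Q := by
  refine le_antisymm ?_ fun X hX => ⟨_, _, _, _, _, contractible_distinguished₁ X,
    isZero_zero C, hX⟩
  rintro X ⟨Y, Z, f, g, h, hT, hY, hZ⟩
  have : IsIso g := (Triangle.isZero₁_iff_isIso₂ _ hT).1 hY
  exact Q.prop_of_iso (asIso g).symm hZ

theorem extensionProduct_isZero (Q : ObjectProperty C) [Q.IsClosedUnderIsomorphisms] :
    Q.extensionProduct IsZero = Q := by
  refine le_antisymm ?_ fun X hX => ⟨_, _, _, _, _, contractible_distinguished X,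
    hX, isZero_zero C⟩
  rintro X ⟨Y, Z, f, g, h, hT, hY, hZ⟩
  have : IsIso f := (Triangle.isZero₃_iff_isIso₁ _ hT).1 hZ
  exact Q.prop_of_iso (asIso f) hY

theorem shift_le_extensionHull [P.IsClosedUnderIsomorphisms] {I : Set ℤ} {a : ℤ} (ha : a ∈ I) :
    P.shift a ≤ extensionHull P I := fun X hX =>
  ⟨[a], by simpa using ha, (extensionProduct_isZero (P.shift a)).ge X hX⟩

theorem le_extensionHull [P.IsClosedUnderIsomorphisms] {I : Set ℤ} (h : 0 ∈ I) :
    P ≤ extensionHull P I := by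
  simpa only [P.shift_zero] using shift_le_extensionHull (P := P) h

theorem extensionWord_append [IsTriangulated C] (l l' : List ℤ) :
    extensionWord P (l ++ l') = (extensionWord P l).extensionProduct (extensionWord P l') := by
  induction l with
  | nil => exact (isZero_extensionProduct _).symm
  | cons a l ih =>
    rw [List.cons_append, extensionWord, extensionWord, ih, ObjectProperty.extensionProduct_assoc]

instance extensionHull_isTriangulatedClosed₂ [IsTriangulated C] (I : Set ℤ) :
    (extensionHull P I).IsTriangulatedClosed₂ :=
  .mk' fun _ hT ⟨l, hl, h⟩ ⟨l', hl', h'⟩ =>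
    ⟨l ++ l', List.forall_mem_append.2 ⟨hl, hl'⟩, by
      rw [extensionWord_append]; exact ⟨_, _, _, _, _, hT, h, h'⟩⟩

instance shift_isTriangulatedClosed₂ (Q : ObjectProperty C) [Q.IsClosedUnderIsomorphisms]
    [Q.IsTriangulatedClosed₂] (a : ℤ) : (Q.shift a).IsTriangulatedClosed₂ :=
  .mk' fun T hT h₁ h₃ =>
    Q.ext_of_isTriangulatedClosed₂ _ (Triangle.shift_distinguished T hT a) h₁ h₃

theorem extensionHull_shift [IsTriangulated C] [P.IsClosedUnderIsomorphisms] {I J : Set ℤ}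
    {n : ℤ} (h : ∀ a ∈ I, a - n ∈ J) {X : C} (hX : extensionHull P I X) :
    extensionHull P J (X⟦n⟧) := by
  refine extensionHull_le (Q := (extensionHull P J).shift n) (fun a ha Y hY => ?_) X hX
  refine shift_le_extensionHull (h a ha) _ ((prop_shift_shift_iff P _ n Y).2 ?_)
  rwa [add_sub_cancel]

instance [IsTriangulated C] [P.IsClosedUnderIsomorphisms] :
    (extensionHull P Set.univ).IsTriangulated where
  isStableUnderShiftBy _ := ⟨fun _ hX => extensionHull_shift (fun _ _ => Set.mem_univ _) hX⟩

theorem hom_eq_zero_of_extensionHull [IsSimpleMinded P] {I J : Set ℤ}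
    (h : ∀ a ∈ I, ∀ b ∈ J, a < b) {X Y : C} (hX : extensionHull P I X)
    (hY : extensionHull P J Y) (f : X ⟶ Y) : f = 0 := by
  refine extensionHull_le (Q := (extensionHull P J).leftOrthogonal) (fun a ha X hX Y f hY => ?_)
    X hX f hY
  exact extensionHull_le (Q := (P.shift a).rightOrthogonal)
    (fun b hb Y hY X f hX => hom_eq_zero_of_shift (h a ha b hb) hX hY f) Y hY f hX

theorem exists_bounds_of_extensionHull {X : C} {I : Set ℤ} (hX : extensionHull P I X) :
    ∃ a b : ℤ, extensionHull P (Set.Ici a) X ∧ extensionHull P (Set.Iic b) X := by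
  obtain ⟨l, -, hX⟩ := hX
  obtain ⟨a, ha⟩ := l.toFinset.bddBelow
  obtain ⟨b, hb⟩ := l.toFinset.bddAbove
  exact ⟨a, b, ⟨l, fun i hi => ha (by simpa using hi), hX⟩,
    l, fun i hi => hb (by simpa using hi), hX⟩

theorem extensionProduct_swap_of_mor₃_eq_zero {Q R : ObjectProperty C} {T : Triangle C}
    (hT : T ∈ distTriang C) (h : T.mor₃ = 0) (h₁ : Q T.obj₁) (h₃ : R T.obj₃) :
    R.extensionProduct Q T.obj₂ := by
  obtain ⟨e, -, -⟩ := exists_iso_binaryBiproduct_of_distTriang _ hT h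
  exact ObjectProperty.prop_of_iso _ (biprod.braiding T.obj₃ T.obj₁ ≪≫ e.symm)
    ⟨_, _, _, _, _, binaryBiproductTriangle_distinguished T.obj₃ T.obj₁, h₃, h₁⟩

theorem extensionProduct_shift_swap [IsSimpleMinded P] {a b : ℤ} (hab : b < a) :
    (P.shift a).extensionProduct (P.shift b) ≤ (P.shift b).extensionProduct (P.shift a) := by
  -- The connecting morphism `P[-b] → P[1-a]` vanishes, or `b = a - 1` and it is invertible.
  rintro X ⟨Y, Z, f, g, h, hT, hY, hZ⟩
  by_cases h0 : h = 0
  · exact extensionProduct_swap_of_mor₃_eq_zero hT h0 hY hZ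
  · have hY' : P.shift (a - 1) (Y⟦(1 : ℤ)⟧) :=
      (prop_shift_shift_iff P _ 1 Y).2 (by rwa [add_sub_cancel])
    obtain rfl : b = a - 1 := by
      by_contra hne
      exact h0 (hom_eq_zero_of_shift (by omega) hZ hY' h)
    have hX : IsZero X := Triangle.isZero₂_of_isIso₃ _ hT (isIso_of_shift hZ hY' h h0)
    exact ObjectProperty.le_extensionProduct_left _ X (ObjectProperty.prop_of_isZero _ hX)

section

variable [IsTriangulated C] [IsSimpleMinded P]

theorem extensionWord_cons_le_orderedInsert (a : ℤ) (l : List ℤ) :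
    extensionWord P (a :: l) ≤ extensionWord P (l.orderedInsert (· ≤ ·) a) := by
  induction l with
  | nil => exact le_rfl
  | cons b l ih =>
    rw [List.orderedInsert_cons]
    split_ifs with h
    · exact le_rfl
    · calc extensionWord P (a :: b :: l)
          = ((P.shift a).extensionProduct (P.shift b)).extensionProduct (extensionWord P l) :=
            (ObjectProperty.extensionProduct_assoc _ _ _).symm
        _ ≤ ((P.shift b).extensionProduct (P.shift a)).extensionProduct (extensionWord P l) :=
            ObjectProperty.monotone_extensionProduct_left _
              (extensionProduct_shift_swap (not_le.1 h))
        _ = (P.shift b).extensionProduct (extensionWord P (a :: l)) :=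
            ObjectProperty.extensionProduct_assoc _ _ _
        _ ≤ _ := ObjectProperty.monotone_extensionProduct_right _ ih

theorem extensionWord_le_insertionSort (l : List ℤ) :
    extensionWord P l ≤ extensionWord P (l.insertionSort (· ≤ ·)) := by
  induction l with
  | nil => exact le_rfl
  | cons a l ih =>
    exact (ObjectProperty.monotone_extensionProduct_right _ ih).trans
      (extensionWord_cons_le_orderedInsert a _)

theorem extensionHull_sorted {I : Set ℤ} {X : C} (hX : extensionHull P I X) :
    ∃ l : List ℤ, l.Pairwise (· ≤ ·) ∧ (∀ a ∈ l, a ∈ I) ∧ extensionWord P l X :=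
  let ⟨l, hl, h⟩ := hX
  ⟨l.insertionSort (· ≤ ·), List.pairwise_insertionSort _ l,
    fun a ha => hl a ((List.mem_insertionSort _).1 ha), extensionWord_le_insertionSort l X h⟩

theorem extensionHull_le_extensionProduct (n : ℤ) (I : Set ℤ) :
    extensionHull P I ≤
      (extensionHull P (Set.Iic n)).extensionProduct (extensionHull P (Set.Ioi n)) := by
  intro X hX
  replace hX := extensionHull_sorted hX
  obtain ⟨l, hl, -, hX⟩ := hX
  induction l generalizing X with
  | nil => exact ObjectProperty.le_extensionProduct_left _ X (ObjectProperty.prop_of_isZero _ hX)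
  | cons a l ih =>
    rw [List.pairwise_cons] at hl
    by_cases ha : a ≤ n
    · refine ObjectProperty.monotone_extensionProduct_left _
        (ObjectProperty.extensionProduct_le_of_isTriangulatedClosed₂
          (shift_le_extensionHull (Set.mem_Iic.2 ha)) le_rfl) X ?_
      rw [ObjectProperty.extensionProduct_assoc]
      exact ObjectProperty.monotone_extensionProduct_right _ (fun Y => ih Y hl.2) X hX
    · have h : ∀ b ∈ a :: l, n < b :=
        List.forall_mem_cons.2 ⟨not_le.1 ha, fun b hb => (not_le.1 ha).trans_le (hl.1 b hb)⟩
      exact ObjectProperty.le_extensionProduct_right _ X ⟨a :: l, h, hX⟩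

end

theorem nonempty_retract_cone {W M X M' X' : C} (r : Retract M X) {f : W ⟶ M} {g : M ⟶ M'}
    {h : M' ⟶ W⟦(1 : ℤ)⟧} (hM : Triangle.mk f g h ∈ distTriang C) {g' : X ⟶ X'}
    {h' : X' ⟶ W⟦(1 : ℤ)⟧} (hX : Triangle.mk (f ≫ r.i) g' h' ∈ distTriang C) :
    Nonempty (Retract M' X') := by
  let φ := completeDistinguishedTriangleMorphism _ _ hM hX (𝟙 W) r.i (Category.id_comp _).symm
  let ψ := completeDistinguishedTriangleMorphism _ _ hX hM (𝟙 W) r.r (by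
    change (f ≫ r.i) ≫ r.r = 𝟙 W ≫ f
    rw [Category.assoc, r.retract, Category.comp_id, Category.id_comp])
  have h₁ : (φ ≫ ψ).hom₁ = 𝟙 W := Category.comp_id (𝟙 W)
  have h₂ : (φ ≫ ψ).hom₂ = 𝟙 M := r.retract
  let c : M' ⟶ X' := φ.hom₃
  let c' : X' ⟶ M' := ψ.hom₃
  have : IsIso (c ≫ c') := isIso₃_of_isIso₁₂ (φ ≫ ψ) hM hM
    (h₁ ▸ inferInstanceAs (IsIso (𝟙 W))) (h₂ ▸ inferInstanceAs (IsIso (𝟙 M)))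
  exact ⟨⟨c, c' ≫ inv (c ≫ c'), by rw [← Category.assoc, IsIso.hom_inv_id]⟩⟩

section

variable [IsTriangulated C] [IsSimpleMinded P]

theorem exists_extensionWord_cone {X Y Z : C} {f : X ⟶ Y} {g : Y ⟶ Z} {h : Z ⟶ X⟦(1 : ℤ)⟧}
    (hT : Triangle.mk f g h ∈ distTriang C) {a : ℤ} {l : List ℤ} (hl : ∀ b ∈ l, a ≤ b)
    (hX : P.shift a X) (hY : extensionWord P l Y) (hf : f ≠ 0) :
    ∃ l', l'.length + 1 = l.length ∧ extensionWord P l' Z := by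
  induction l generalizing Y Z with
  | nil => exact (hf (IsZero.eq_of_tgt hY _ _)).elim
  | cons b l ih =>
    rw [List.forall_mem_cons] at hl
    obtain ⟨Y₁, Y₂, u, v, w, hT', h₁, h₂⟩ := hY
    by_cases hv : f ≫ v = 0
    · obtain ⟨φ, hφf⟩ : ∃ φ : X ⟶ Y₁, f = φ ≫ u := Triangle.coyoneda_exact₂ _ hT' f hv
      have hφ : φ ≠ 0 := fun h0 => hf (by rw [hφf, h0, zero_comp])
      obtain rfl : a = b := by
        by_contra hne
        exact hφ (hom_eq_zero_of_shift (lt_of_le_of_ne hl.1 hne) hX h₁ φ)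
      have := isIso_of_shift hX h₁ φ hφ
      obtain ⟨e, -⟩ := exists_iso_of_arrow_iso _ _ hT hT'
        (Arrow.isoMk (@asIso _ _ X Y₁ φ this) (Iso.refl _)
          (hφf.symm.trans (Category.comp_id f).symm))
      exact ⟨l, rfl, (extensionWord P l).prop_of_iso (Triangle.π₃.mapIso e.symm) h₂⟩
    · obtain ⟨W, r, s, hW⟩ := distinguished_cocone_triangle (f ≫ v)
      obtain ⟨l', hl', hWl⟩ := ih hW hl.2 h₂ hv
      let o := Triangulated.someOctahedron rfl hT (rot_of_distTriang _ hT') hW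
      exact ⟨b :: l', by simpa using hl', _, _, _, _, _, inv_rot_of_distTriang _ o.mem,
        (P.shift b).prop_of_iso ((shiftEquiv C (1 : ℤ)).unitIso.app Y₁) h₁, hWl⟩

/- Let `W` in `P[-a]` be the first factor of `X`, where `a` is minimal. If `W → X → M` vanishes,
then `M` is a retract of the cone of `W → X`. Otherwise the cone of `W → M` is a retract of the
cone of `W → M → X`, which has one factor less than `X`. -/
theorem extensionHull_of_retract {M X : C} (r : Retract M X) {l : List ℤ}
    (hX : extensionWord P l X) : extensionHull P Set.univ M := by
  induction hn : l.length generalizing M X l with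
  | zero =>
    obtain rfl := List.length_eq_zero_iff.1 hn
    refine ObjectProperty.prop_of_isZero _ ((IsZero.iff_id_eq_zero M).2 ?_)
    rw [← r.retract, IsZero.eq_of_tgt hX r.i 0, zero_comp]
  | succ n ih =>
    replace hX := extensionWord_le_insertionSort l X hX
    have hs := List.pairwise_insertionSort (· ≤ ·) l
    rw [← List.length_insertionSort (· ≤ ·) l] at hn
    generalize l.insertionSort (· ≤ ·) = l at hX hs hn
    obtain _ | ⟨a, l⟩ := l
    · cases hn
    rw [List.pairwise_cons] at hs
    obtain ⟨W, Y, u, v, w, hT, hW, hY⟩ := id hX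
    by_cases h0 : u ≫ r.r = 0
    · obtain ⟨s, hs⟩ : ∃ s : Y ⟶ M, r.r = v ≫ s := Triangle.yoneda_exact₂ _ hT r.r h0
      have retract : (r.i ≫ v) ≫ s = 𝟙 M := by rw [Category.assoc, ← hs, r.retract]
      exact ih ⟨r.i ≫ v, s, retract⟩ hY (Nat.succ.inj hn)
    · obtain ⟨M', p, q, hM'⟩ := distinguished_cocone_triangle (u ≫ r.r)
      obtain ⟨X', p', q', hX'⟩ := distinguished_cocone_triangle ((u ≫ r.r) ≫ r.i)
      have hne : (u ≫ r.r) ≫ r.i ≠ 0 := fun h => h0 (by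
        simpa only [Category.assoc, r.retract, Category.comp_id, zero_comp] using h =≫ r.r)
      obtain ⟨l', hl', hw⟩ := exists_extensionWord_cone hX'
        (List.forall_mem_cons.2 ⟨le_rfl, hs.1⟩) hW hX hne
      obtain ⟨r'⟩ := nonempty_retract_cone r hM' hX'
      exact ObjectProperty.ext_of_isTriangulatedClosed₂ _ _ hM'
        (shift_le_extensionHull (Set.mem_univ a) W hW)
        (ih r' hw (Nat.succ.inj (hl'.trans hn)))

instance : (extensionHull P Set.univ).IsStableUnderRetracts where
  of_retract r := fun ⟨_, _, h⟩ => extensionHull_of_retract r h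

end

/-! ### The t-structure of a simple-minded class -/

section

namespace IsDetectedBy

variable {Z : ObjectProperty C} [Z.IsClosedUnderIsomorphisms] [Z.ContainsZero]
  [Z.IsTriangulatedClosed₂] (hZ : IsDetectedBy P Z)
include hZ

theorem of_extensionHull {I : Set ℤ} {i : ℤ} (hi : i ∉ I) {X : C} (hX : extensionHull P I X) :
    Z.shift i X :=
  extensionHull_le (fun _ ha => hZ.shift_le (ne_of_mem_of_not_mem ha hi)) X hX

theorem extensionHull_iff [IsTriangulated C] [IsSimpleMinded P] {I : Set ℤ} {X : C}
    (hX : extensionHull P Set.univ X) : extensionHull P I X ↔ ∀ i ∉ I, Z.shift i X := by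
  refine ⟨fun h i hi => hZ.of_extensionHull hi h, fun h => ?_⟩
  replace hX := extensionHull_sorted hX
  obtain ⟨l, hl, -, hX⟩ := hX
  induction l generalizing X with
  | nil => exact ObjectProperty.prop_of_isZero _ hX
  | cons a l ih =>
    rw [List.pairwise_cons] at hl
    obtain ⟨W, Y, f, g, _, hT, hW, hlY⟩ := hX
    have hY_pred : Z.shift (a - 1) Y := hZ.of_extensionHull (I := Set.Ici a) (by simp)
      ⟨l, hl.1, hlY⟩
    have hY : extensionHull P I Y := ih (fun i hi => ?_) hl.2 hlY
    · by_cases ha : a ∈ I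
      · exact ObjectProperty.ext_of_isTriangulatedClosed₂ _ _ hT
          (shift_le_extensionHull ha W hW) hY
      · have hZW : Z.shift a W := ObjectProperty.ext_of_isTriangulatedClosed₂ _ _
          (inv_rot_of_distTriang _ hT)
          ((prop_shift_shift_iff Z a (-1) Y).2 (by rwa [neg_add_eq_sub])) (h a ha)
        have : IsIso g := (Triangle.isZero₁_iff_isIso₂ _ hT).1 <|
          IsZero.of_full_of_faithful_of_isZero (shiftFunctor C a) W (hZ.isZero hW hZW)
        exact ObjectProperty.prop_of_iso _ (asIso g).symm hY
    · by_cases hia : a = i + 1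
      · rwa [hia, add_sub_cancel_right] at hY_pred
      · exact ObjectProperty.ext_of_isTriangulatedClosed₂ _ _ (rot_of_distTriang _ hT) (h i hi)
          ((prop_shift_shift_iff Z i 1 W).2 (hZ.shift_le (by omega) W hW))

end IsDetectedBy

theorem exists_distTriang_fullSubcategory (Q : ObjectProperty C) [Q.IsTriangulated]
    {X Y Z : Q.FullSubcategory} {f : X.obj ⟶ Y.obj} {g : Y.obj ⟶ Z.obj}
    {h : Z.obj ⟶ X.obj⟦(1 : ℤ)⟧} (hT : Triangle.mk f g h ∈ distTriang C) :
    ∃ (f' : X ⟶ Y) (g' : Y ⟶ Z) (h' : Z ⟶ X⟦(1 : ℤ)⟧),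
      Triangle.mk f' g' h' ∈ distTriang Q.FullSubcategory := by
  refine ⟨Q.fullyFaithfulι.preimage f, Q.fullyFaithfulι.preimage g,
    Q.fullyFaithfulι.preimage (h ≫ (Q.ι.commShiftIso (1 : ℤ)).inv.app X),
    isomorphic_distinguished _ hT _
      (Triangle.isoMk _ _ (Iso.refl _) (Iso.refl _) (Iso.refl _) ?_ ?_ ?_)⟩
  · exact (Category.comp_id f).trans (Category.id_comp f).symm
  · exact (Category.comp_id g).trans (Category.id_comp g).symm
  · change ((h ≫ (Q.ι.commShiftIso (1 : ℤ)).inv.app X) ≫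
      (Q.ι.commShiftIso (1 : ℤ)).hom.app X) ≫ (𝟙 X.obj)⟦(1 : ℤ)⟧' = 𝟙 _ ≫ h
    refine Eq.trans ?_ (Category.id_comp h).symm
    exact (congrArg (_ ≫ ·) ((shiftFunctor C (1 : ℤ)).map_id X.obj)).trans <|
      (Category.comp_id _).trans <| (Category.assoc _ _ _).trans <|
        (congrArg (h ≫ ·) (Iso.inv_hom_id_app _ X)).trans (Category.comp_id h)

/-- The t-structure on the triangulated subcategory `Q` generated by a simple-minded class `P`
whose halves are the extensions of shifts `P[-a]` with `a ≤ n` and `a ≥ n`. -/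
def extensionTStructure (P : ObjectProperty C) [IsTriangulated C] [IsSimpleMinded P]
    {Q : ObjectProperty C} [Q.IsTriangulated] (hQ : Q = extensionHull P Set.univ) :
    Triangulated.TStructure Q.FullSubcategory where
  le n := (extensionHull P (Set.Iic n)).inverseImage Q.ι
  ge n := (extensionHull P (Set.Ici n)).inverseImage Q.ι
  le_shift n a n' h X hX := ObjectProperty.prop_of_iso (extensionHull P (Set.Iic n'))
      ((Q.ι.commShiftIso a).symm.app X) <|
    extensionHull_shift (fun i (hi : i ≤ n) => Set.mem_Iic.2 (by omega)) hX
  ge_shift n a n' h X hX := ObjectProperty.prop_of_iso (extensionHull P (Set.Ici n'))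
      ((Q.ι.commShiftIso a).symm.app X) <|
    extensionHull_shift (fun i (hi : n ≤ i) => Set.mem_Ici.2 (by omega)) hX
  zero' X Y f hX hY := Q.ι.map_injective <|
    (hom_eq_zero_of_extensionHull (fun i (hi : i ≤ 0) j (hj : 1 ≤ j) => by omega) hX hY _).trans
      (Functor.map_zero _ _ _).symm
  le_zero_le X hX := extensionHull_mono (Set.Iic_subset_Iic.2 zero_le_one) _ hX
  ge_one_le X hX := extensionHull_mono (Set.Ici_subset_Ici.2 zero_le_one) _ hX
  exists_triangle_zero_one X := by
    obtain ⟨Y, Z, f, g, h, hT, hY, hZ⟩ :=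
      extensionHull_le_extensionProduct 0 Set.univ X.obj (hQ.le _ X.property)
    let Y' : Q.FullSubcategory := ⟨Y, hQ.ge Y (extensionHull_mono (Set.subset_univ _) Y hY)⟩
    let Z' : Q.FullSubcategory := ⟨Z, hQ.ge Z (extensionHull_mono (Set.subset_univ _) Z hZ)⟩
    obtain ⟨f', g', h', hT'⟩ := exists_distTriang_fullSubcategory Q (X := Y') (Z := Z') hT
    exact ⟨Y', Z', hY, hZ, f', g', h', hT'⟩

theorem isBoundedTStructure_extensionTStructure [IsTriangulated C] [IsSimpleMinded P]
    {Q : ObjectProperty C} [Q.IsTriangulated] (hQ : Q = extensionHull P Set.univ) :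
    IsBoundedTStructure (extensionTStructure P hQ) := fun X =>
  exists_bounds_of_extensionHull (P := P) (hQ.le _ X.property)

theorem IsBoundedTStructure.isNondegenerateTStructure {t : Triangulated.TStructure C}
    (ht : IsBoundedTStructure t) : IsNondegenerateTStructure t := by
  refine ⟨fun X hX => ?_, fun X hX => ?_⟩ <;> obtain ⟨a, b, ha, hb⟩ := ht X
  · have : t.IsLE X (a - 1) := ⟨hX _⟩
    have : t.IsGE X a := ⟨ha⟩
    exact t.isZero X (a - 1) a (by omega)
  · have : t.IsLE X b := ⟨hb⟩
    have : t.IsGE X (b + 1) := ⟨hX _⟩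
    exact t.isZero X b (b + 1) (by omega)

end

end

/-! ### The dg modules `L̂ = L ⊗_{A^0} A` -/

namespace DGMod

variable {A : DGAlgebra.{w, u} k}

section

variable {L L₁ : Type u} [AddCommGroup L] [Module (A.gr 0)ᵐᵒᵖ L] [AddCommGroup L₁]
  [Module (A.gr 0)ᵐᵒᵖ L₁] (hA : A.ZeroDiff)

/-- The element `l ⊗ a` of `L̂`, as a biadditive function of `a` and `l`. -/
def hatMk : A →+ L →+ hat L hA :=
  AddMonoidHom.mk' (fun a => (rel L A).mkQ.toAddMonoidHom.comp
    (TensorProduct.mk ℤ (A : Type u) L a).toAddMonoidHom) fun a b => AddMonoidHom.ext fun l =>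
      (congrArg (rel L A).mkQ (TensorProduct.add_tmul a b l)).trans (map_add _ _ _)

theorem smul_hatMk (a b : A) (l : L) : op b • hatMk hA a l = hatMk hA (a * b) l := rfl

theorem d_hatMk (a : A) (l : L) : (hat L hA).d (hatMk hA a l) = hatMk hA (A.d a) l := rfl

theorem hatMk_coe_mul (a₀ : A.gr 0) (a : A) (l : L) :
    hatMk hA ((a₀ : A) * a) l = hatMk hA a (op a₀ • l) :=
  (Submodule.Quotient.eq (rel L A)).2 (AddSubgroup.subset_closure ⟨a₀, a, l, rfl⟩)

theorem hatMk_coe (a₀ : A.gr 0) (l : L) : hatMk hA (a₀ : A) l = hatMk hA 1 (op a₀ • l) := by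
  rw [← hatMk_coe_mul, mul_one]

theorem hatMk_eq_smul (a : A) (l : L) : hatMk hA a l = op a • hatMk hA 1 l := by
  rw [smul_hatMk, one_mul]

theorem hatMk_mem {i : ℤ} {a : A} (ha : a ∈ A.gr i) (l : L) : hatMk hA a l ∈ (hat L hA).gr i :=
  ⟨_, AddSubgroup.subset_closure ⟨a, ha, l, rfl⟩, rfl⟩

theorem hatMk_one_mem (l : L) : hatMk hA 1 l ∈ (hat L hA).gr 0 :=
  hatMk_mem hA (SetLike.GradedOne.one_mem (A := A.gr)) l

theorem d_hatMk_one (l : L) : (hat L hA).d (hatMk hA 1 l) = 0 := by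
  rw [d_hatMk, hA _ (SetLike.GradedOne.one_mem (A := A.gr)), map_zero, AddMonoidHom.zero_apply]

variable {hA} in
theorem hat_addHom_ext {M : Type*} [AddCommGroup M] {f g : hat L hA →+ M}
    (h : ∀ a l, f (hatMk hA a l) = g (hatMk hA a l)) : f = g := by
  have hfg : (f.comp (rel L A).mkQ.toAddMonoidHom).toIntLinearMap =
      (g.comp (rel L A).mkQ.toAddMonoidHom).toIntLinearMap := TensorProduct.ext' h
  exact AddMonoidHom.ext ((rel L A).mkQ_surjective.forall.2 (DFunLike.congr_fun hfg))

variable {hA} in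
theorem hat_hom_ext {M : DGMod A} {f g : Hom (hat L hA) M}
    (h : ∀ l, f.lin (hatMk hA 1 l) = g.lin (hatMk hA 1 l)) : f = g :=
  Hom.ext <| LinearMap.toAddMonoidHom_injective <| hat_addHom_ext fun a l => by
    change f.lin _ = g.lin _
    rw [hatMk_eq_smul, map_smul, map_smul, h]

variable {hA} in
theorem hat_gr_le {i : ℤ} {S : AddSubgroup (hat L hA)}
    (h : ∀ a ∈ A.gr i, ∀ l, hatMk hA a l ∈ S) : (hat L hA).gr i ≤ S := by
  refine AddSubgroup.map_le_iff_le_comap.2 ((AddSubgroup.closure_le _).2 ?_)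
  rintro _ ⟨a, ha, l, rfl⟩
  exact h a ha l

/-- The `A`-linear map `l ⊗ a ↦ φ(l) a` from `L ⊗_ℤ A` to a dg module `M`. -/
def tensLift {M : DGMod A} (φ : L →+ M) : tens L A →ₗ[(A : Type u)ᵐᵒᵖ] M :=
  TensorProduct.AlgebraTensorModule.lift
    { toFun := fun a => op a • φ.toIntLinearMap
      map_add' := fun a b => add_smul (op a) (op b) φ.toIntLinearMap
      map_smul' := fun c a => mul_smul c (op a) φ.toIntLinearMap }

theorem rel_le_ker_tensLift {M : DGMod A} {φ : L →+ M}
    (hφ : ∀ (a₀ : A.gr 0) l, φ (op a₀ • l) = op (a₀ : A) • φ l) :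
    rel L A ≤ LinearMap.ker (tensLift φ) := by
  refine (AddSubgroup.closure_le (LinearMap.ker (tensLift φ)).toAddSubgroup).2 ?_
  rintro _ ⟨a₀, a, l, rfl⟩
  change tensLift φ (_ - _) = 0
  rw [map_sub, sub_eq_zero]
  change op ((a₀ : A) * a) • φ l = op a • φ (op a₀ • l)
  rw [hφ, MulOpposite.op_mul, mul_smul]

/-- The morphism of dg modules `L̂ → M`, `l ⊗ a ↦ φ(l) a`, defined by an `A^0`-linear map `φ` from
`L` to the cocycles of degree zero of `M`. -/
def hatLift {M : DGMod A} (φ : L →+ M) (hφ : ∀ l, φ l ∈ M.cocycles 0)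
    (hsmul : ∀ (a₀ : A.gr 0) l, φ (op a₀ • l) = op (a₀ : A) • φ l) : Hom (hat L hA) M where
  lin := (rel L A).liftQ (tensLift φ) (rel_le_ker_tensLift hsmul)
  map_mem {i x} hx := by
    refine hat_gr_le (S := (M.gr i).comap
      ((rel L A).liftQ _ (rel_le_ker_tensLift hsmul)).toAddMonoidHom) (fun a ha l => ?_) hx
    change op a • φ l ∈ M.gr i
    simpa only [zero_add] using M.smul_mem (hφ l).2 ha
  comm := DFunLike.congr_fun <| hat_addHom_ext (hA := hA)
      (f := ((rel L A).liftQ _ (rel_le_ker_tensLift hsmul)).toAddMonoidHom.comp (hat L hA).d)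
      (g := M.d.comp ((rel L A).liftQ _ (rel_le_ker_tensLift hsmul)).toAddMonoidHom) fun a l => by
    change op (A.d a) • φ l = M.d (op a • φ l)
    rw [M.leibniz a (hφ l).2, show M.d (φ l) = 0 from (hφ l).1, smul_zero, zero_add,
      Int.negOnePow_zero, one_smul]

/-- The morphism `L̂ → L̂₁` induced by an `A^0`-linear map. -/
def hatMap (f : L →ₗ[(A.gr 0)ᵐᵒᵖ] L₁) : Hom (hat L hA) (hat L₁ hA) :=
  hatLift hA ((hatMk hA 1).comp f.toAddMonoidHom)
    (fun l => ⟨d_hatMk_one hA (f l), hatMk_one_mem hA (f l)⟩) fun a₀ l => by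
      change hatMk hA 1 (f (op a₀ • l)) = op (a₀ : A) • hatMk hA 1 (f l)
      rw [map_smul, ← hatMk_coe, hatMk_eq_smul]

theorem hatMap_hatMk (f : L →ₗ[(A.gr 0)ᵐᵒᵖ] L₁) (a : A) (l : L) :
    (hatMap hA f).lin (hatMk hA a l) = hatMk hA a (f l) :=
  (hatMk_eq_smul hA a (f l)).symm

theorem hatMap_add (f g : L →ₗ[(A.gr 0)ᵐᵒᵖ] L₁) :
    hatMap hA (f + g) = hatMap hA f + hatMap hA g := hat_hom_ext fun l => by
  rw [Hom.lin_add, LinearMap.add_apply, hatMap_hatMk, hatMap_hatMk, hatMap_hatMk,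
    LinearMap.add_apply, map_add]

/-- The projection `L̂ → L`, `l ⊗ a ↦ l a₀`, where `a₀` is the component of degree zero of `a`. -/
def hatProj : hat L hA →+ L :=
  let r : A →+ (A.gr 0)ᵐᵒᵖ := MulOpposite.opAddEquiv.toAddMonoidHom.comp
    ((DFinsupp.evalAddMonoidHom 0).comp (DirectSum.decomposeAddEquiv A.gr).toAddMonoidHom)
  QuotientAddGroup.lift (rel L A).toAddSubgroup
    (TensorProduct.liftAddHom ((smulAddHom (A.gr 0)ᵐᵒᵖ L).comp r) fun n a l => by
      rw [map_zsmul, map_zsmul, AddMonoidHom.zsmul_apply]) <| by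
    refine (AddSubgroup.closure_le _).2 ?_
    rintro _ ⟨a₀, a, l, rfl⟩
    refine (map_sub _ _ _).trans (sub_eq_zero.2 ?_)
    change op (DirectSum.decompose A.gr ((a₀ : A) * a) 0) • l =
      op (DirectSum.decompose A.gr a 0) • op a₀ • l
    have hmul : DirectSum.decompose A.gr ((a₀ : A) * a) 0 = a₀ * DirectSum.decompose A.gr a 0 :=
      Subtype.ext (DirectSum.coe_decompose_mul_of_left_mem_zero A.gr a₀.2)
    rw [hmul, MulOpposite.op_mul, mul_smul]

theorem hatProj_hatMk (a : A) (l : L) :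
    hatProj hA (hatMk hA a l) = op (DirectSum.decompose A.gr a 0) • l := rfl

theorem hatProj_hatMk_coe (a₀ : A.gr 0) (l : L) :
    hatProj hA (hatMk hA (a₀ : A) l) = op a₀ • l := by
  rw [hatProj_hatMk, DirectSum.decompose_coe, DirectSum.of_eq_same]

theorem hatProj_hatMk_one (l : L) : hatProj hA (hatMk hA 1 l) = l :=
  (hatProj_hatMk_coe hA 1 l).trans (one_smul (A.gr 0)ᵐᵒᵖ l)

theorem hatProj_hatMk_of_ne {i : ℤ} (hi : i ≠ 0) {a : A} (ha : a ∈ A.gr i) (l : L) :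
    hatProj hA (hatMk hA a l) = 0 := by
  have h0 : DirectSum.decompose A.gr a 0 = 0 :=
    Subtype.ext (DirectSum.decompose_of_mem_ne A.gr ha hi)
  rw [hatProj_hatMk, h0]
  exact zero_smul (A.gr 0)ᵐᵒᵖ l

theorem hatMk_hatProj {x : hat L hA} (hx : x ∈ (hat L hA).gr 0) :
    hatMk hA 1 (hatProj hA x) = x := by
  refine hat_gr_le (S := ((hatMk hA 1).comp (hatProj hA)).eqLocus (AddMonoidHom.id _))
    (fun a ha l => ?_) hx
  change hatMk hA 1 (hatProj hA (hatMk hA a l)) = hatMk hA a l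
  lift a to A.gr 0 using ha
  rw [hatProj_hatMk_coe, hatMk_coe]

theorem hatProj_smul (a₀ : A.gr 0) {x : hat L hA} (hx : x ∈ (hat L hA).gr 0) :
    hatProj hA (op (a₀ : A) • x) = op a₀ • hatProj hA x := by
  conv_lhs => rw [← hatMk_hatProj hA hx, ← hatMk_eq_smul, hatProj_hatMk_coe]

theorem hatMap_surjective (f : Hom (hat L hA) (hat L₁ hA)) :
    ∃ g : L →ₗ[(A.gr 0)ᵐᵒᵖ] L₁, hatMap hA g = f := by
  have hf (l : L) : f.lin (hatMk hA 1 l) ∈ (hat L₁ hA).gr 0 := f.map_mem (hatMk_one_mem hA l)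
  refine ⟨{ toFun := fun l => hatProj hA (f.lin (hatMk hA 1 l))
            map_add' := fun l l' => by rw [map_add, map_add, map_add]
            map_smul' := MulOpposite.rec' fun a₀ l => ?_ }, hat_hom_ext fun l => ?_⟩
  · rw [← hatMk_coe, hatMk_eq_smul, map_smul, hatProj_smul hA _ (hf l), RingHom.id_apply]
  · exact (hatMap_hatMk hA _ 1 l).trans (hatMk_hatProj hA (hf l))

/-- The functor `L ↦ L̂` from right `A^0`-modules to the homotopy category. -/
def hatFunctor : ModuleCat.{u} (A.gr 0)ᵐᵒᵖ ⥤ DGHot A where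
  obj L := ⟨hat L hA⟩
  map f := DGHot.mk (hatMap hA f.hom)
  map_id L := congrArg DGHot.mk (hat_hom_ext fun l => hatMap_hatMk hA _ 1 l)
  map_comp f g := congrArg DGHot.mk (hat_hom_ext fun l => by
    rw [Hom.comp_lin, LinearMap.comp_apply, hatMap_hatMk, hatMap_hatMk, hatMap_hatMk]
    rfl)

instance : (hatFunctor hA).Additive where
  map_add {_ _ f g} := congrArg DGHot.mk (hatMap_add hA f.hom g.hom)

instance : (hatFunctor hA).Full where
  map_surjective f := by
    obtain ⟨f, rfl⟩ := DGHot.mk_surj f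
    obtain ⟨g, rfl⟩ := hatMap_surjective hA f
    exact ⟨ModuleCat.ofHom g, rfl⟩

variable {hA} (hP : A.IsPositive)
include hP

theorem hat_gr_eq_bot {i : ℤ} (hi : i < 0) : (hat L hA).gr i = ⊥ := by
  refine eq_bot_iff.2 (hat_gr_le fun a ha l => ?_)
  rw [hP i hi, Submodule.mem_bot] at ha
  rw [ha, map_zero, AddMonoidHom.zero_apply, AddSubgroup.mem_bot]

theorem mulPosGrp_hat_le_ker_hatProj : (hat L hA).mulPosGrp ≤ (hatProj hA).ker := by
  refine (AddSubgroup.closure_le _).2 ?_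
  rintro _ ⟨x, j, a, hj, ha, rfl⟩
  change hatProj hA (op a • x) = 0
  induction x using (hat L hA).hom_induction with
  | zero => rw [smul_zero, map_zero]
  | add x y hx hy => rw [smul_add, map_add, hx, hy, add_zero]
  | mem i x hx =>
    refine hat_gr_le (S := ((hatProj hA).comp (DistribSMul.toAddMonoidHom _ (op a))).ker)
      (fun b hb l => ?_) hx
    change hatProj hA (op a • hatMk hA b l) = 0
    obtain hi | hi := lt_or_ge i 0
    · rw [hP i hi, Submodule.mem_bot] at hb
      rw [hb, map_zero, AddMonoidHom.zero_apply, smul_zero, map_zero]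
    · exact hatProj_hatMk_of_ne hA (by omega) (SetLike.GradedMul.mul_mem (A := A.gr) hb ha) l

theorem hom_hat_shift_eq_zero {n : ℤ} (hn : n < 0) (f : Hom (hat L hA) ((hat L₁ hA).shift n)) :
    f = 0 := hat_hom_ext fun l => by
  have hf : f.lin (hatMk hA 1 l) ∈ (hat L₁ hA).gr (0 + n) := f.map_mem (hatMk_one_mem hA l)
  rwa [zero_add, hat_gr_eq_bot hP hn] at hf

end

end DGMod

/-! ### Cohomology of `M̄ = M / M A⁺` -/

namespace DGMod

variable {A : DGAlgebra.{w, u} k} {M N : DGMod A}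

theorem map_mem_mulPosGrp_of_linear (f : M →ₗ[(A : Type u)ᵐᵒᵖ] N) {x : M}
    (hx : x ∈ M.mulPosGrp) : f x ∈ N.mulPosGrp := by
  suffices M.mulPosGrp ≤ N.mulPosGrp.comap f.toAddMonoidHom from this hx
  refine (AddSubgroup.closure_le _).2 ?_
  rintro _ ⟨m, j, a, hj, ha, rfl⟩
  change f (op a • m) ∈ N.mulPosGrp
  rw [map_smul]
  exact N.smul_mem_mulPosGrp hj ha _

/-- The condition `H^i(M̄) = 0`, in terms of elements of `M`. -/
def BarExactAt (M : DGMod A) (i : ℤ) : Prop :=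
  ∀ x ∈ M.gr i, M.d x ∈ M.mulPosGrp → ∃ y ∈ M.gr (i - 1), x - M.d y ∈ M.mulPosGrp

theorem notMem_suppH_iff {i : ℤ} : i ∉ M.suppH ↔ M.cocycles i ≤ M.coboundaries i := by
  rw [← AddSubgroup.addSubgroupOf_eq_top, ← QuotientAddGroup.subsingleton_iff]
  exact not_nontrivial_iff_subsingleton

theorem notMem_suppH_bar_iff (hP : A.IsPositive) {i : ℤ} :
    i ∉ (M.bar hP).suppH ↔ M.BarExactAt i := by
  have mkQ_eq_zero (x : M) : (M.mulPos hP).mkQ x = 0 ↔ x ∈ M.mulPosGrp :=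
    Submodule.Quotient.mk_eq_zero _
  have mkQ_eq (x y : M) :
      (M.mulPos hP).mkQ y = (M.mulPos hP).mkQ x ↔ x - y ∈ M.mulPosGrp := by
    rw [← mkQ_eq_zero, map_sub, sub_eq_zero, eq_comm]
  rw [notMem_suppH_iff]
  constructor
  · intro h x hx hdx
    obtain ⟨_, ⟨y, hy, rfl⟩, hxy⟩ :=
      h (x := (M.mulPos hP).mkQ x) ⟨(mkQ_eq_zero (M.d x)).2 hdx, x, hx, rfl⟩
    exact ⟨y, hy, (mkQ_eq x (M.d y)).1 hxy⟩
  · rintro h _ ⟨hdx, x, hx, rfl⟩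
    obtain ⟨y, hy, hxy⟩ := h x hx ((mkQ_eq_zero (M.d x)).1 hdx)
    exact ⟨(M.mulPos hP).mkQ y, ⟨y, hy, rfl⟩, (mkQ_eq x (M.d y)).2 hxy⟩

theorem BarExactAt.of_homotopy {i : ℤ} (hM : M.BarExactAt i) (f : Hom M N) (g : Hom N M)
    (h : IsNull (g.comp f - Hom.id N)) : N.BarExactAt i := by
  obtain ⟨s, hs_mem, hs⟩ := h
  intro x hx hdx
  obtain ⟨y, hy, hxy⟩ := hM (g.lin x) (g.map_mem hx) <| by
    rw [← g.comm]
    exact map_mem_mulPosGrp_of_linear _ hdx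
  refine ⟨f.lin y - s x, sub_mem (f.map_mem hy) (hs_mem i x hx), ?_⟩
  have hsx : f.lin (g.lin x) - x = N.d (s x) + s (N.d x) := by
    rw [← hs, Hom.lin_sub]
    rfl
  have sub_d_eq : x - N.d (f.lin y - s x) = f.lin (g.lin x - M.d y) - s (N.d x) := by
    rw [map_sub, map_sub, f.comm, ← sub_eq_iff_eq_add'.2 hsx]
    abel
  rw [sub_d_eq]
  exact sub_mem (map_mem_mulPosGrp_of_linear _ hxy) (map_mem_mulPosGrp_of_linear _ hdx)

theorem barExactAt_shift_iff {i n : ℤ} : (M.shift n).BarExactAt i ↔ M.BarExactAt (i + n) := by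
  have hgr : (M.shift n).gr (i - 1) = M.gr (i + n - 1) := congrArg M.gr (by ring)
  unfold BarExactAt
  rw [hgr]
  refine forall₂_congr fun x _ => ?_
  change (n.negOnePow • M.d x ∈ M.mulPosGrp → ∃ y ∈ M.gr (i + n - 1),
    x - n.negOnePow • M.d y ∈ M.mulPosGrp) ↔ _
  obtain h | h := Int.units_eq_one_or n.negOnePow
  · simp only [h, one_smul]
  · simp only [h, Units.neg_smul, one_smul, neg_mem_iff]
    refine imp_congr_right fun _ => (Equiv.neg M).exists_congr fun y => ?_
    rw [Equiv.neg_apply, neg_mem_iff, map_neg]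

theorem BarExactAt.of_cone {f : Hom M N} {i : ℤ} (hM : M.BarExactAt i)
    (hf : (cone f).BarExactAt i) : N.BarExactAt i := by
  have fst_mem {x : N × M} (hx : x ∈ (cone f).mulPosGrp) : x.1 ∈ N.mulPosGrp :=
    map_mem_mulPosGrp_of_linear (M := cone f) (LinearMap.fst _ N M) hx
  have snd_mem {x : N × M} (hx : x ∈ (cone f).mulPosGrp) : x.2 ∈ M.mulPosGrp :=
    map_mem_mulPosGrp_of_linear (M := cone f) (LinearMap.snd _ N M) hx
  intro x hx hdx
  obtain ⟨⟨y, z⟩, ⟨hy, hz⟩, hyz⟩ := hf ((coneInl f).lin x) ((coneInl f).map_mem hx) <| by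
    rw [← (coneInl f).comm]
    exact map_mem_mulPosGrp_of_linear _ hdx
  have hxyz : x - (N.d y + f.lin z) ∈ N.mulPosGrp := fst_mem hyz
  have hdz : 0 - -M.d z ∈ M.mulPosGrp := snd_mem hyz
  rw [sub_neg_eq_add, zero_add] at hdz
  rw [sub_add_cancel] at hz
  obtain ⟨t, ht, hzt⟩ := hM z hz hdz
  refine ⟨y + f.lin t, add_mem hy (f.map_mem ht), ?_⟩
  have sub_d_eq : x - N.d (y + f.lin t) = x - (N.d y + f.lin z) + f.lin (z - M.d t) := by
    rw [map_add, map_sub, f.comm]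
    abel
  rw [sub_d_eq]
  exact add_mem hxyz (map_mem_mulPosGrp_of_linear _ hzt)

theorem barExactAt_of_gr_le {i : ℤ} (h : M.gr i ≤ M.mulPosGrp) : M.BarExactAt i :=
  fun x hx _ => ⟨0, zero_mem _, by simpa only [map_zero, sub_zero] using h hx⟩

section

variable {L : Type u} [AddCommGroup L] [Module (A.gr 0)ᵐᵒᵖ L] {hA : A.ZeroDiff}
  (hP : A.IsPositive)
include hP

theorem barExactAt_hat {i : ℤ} (hi : i ≠ 0) : (hat L hA).BarExactAt i := by
  apply barExactAt_of_gr_le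
  obtain hi | hi := hi.lt_or_gt
  · rw [hat_gr_eq_bot hP hi]
    exact bot_le
  · refine hat_gr_le fun a ha l => ?_
    rw [hatMk_eq_smul]
    exact smul_mem_mulPosGrp _ hi ha _

theorem subsingleton_of_barExactAt_hat (h : (hat L hA).BarExactAt 0) : Subsingleton L := by
  refine subsingleton_of_forall_eq 0 fun l => ?_
  obtain ⟨y, hy, hly⟩ := h (hatMk hA 1 l) (hatMk_one_mem hA l) <| by
    rw [d_hatMk_one]
    exact zero_mem _
  rw [hat_gr_eq_bot hP (by norm_num), AddSubgroup.mem_bot] at hy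
  rw [hy, map_zero, sub_zero] at hly
  exact (hatProj_hatMk_one hA l).symm.trans (mulPosGrp_hat_le_ker_hatProj hP hly)

end

end DGMod

namespace DGHot

variable {A : DGAlgebra.{w, u} k}

/-- The objects `M` of `dgHot(A)` with `H^0(M̄) = 0`, whose shifts detect the support of `H(M̄)`. -/
def barExact (A : DGAlgebra.{w, u} k) : ObjectProperty (DGHot A) := fun X => X.as.BarExactAt 0

theorem barExact_shift_iff {n : ℤ} {X : DGHot A} :
    (barExact A).shift n X ↔ X.as.BarExactAt n :=
  DGMod.barExactAt_shift_iff.trans (by rw [zero_add])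

instance : (barExact A).IsClosedUnderIsomorphisms where
  of_iso {X Y} e hX := by
    obtain ⟨f, hf⟩ := mk_surj e.hom
    obtain ⟨g, hg⟩ := mk_surj e.inv
    refine DGMod.BarExactAt.of_homotopy hX f g ((mk_eq_iff _ _).1 ?_)
    rw [← mk_comp, hf, hg]
    exact e.inv_hom_id

instance : (barExact A).ContainsZero where
  exists_zero := ⟨⟨DGMod.zero A⟩, (IsZero.iff_id_eq_zero _).2 (mk_eq_of_lin fun _ => rfl),
    fun _ _ _ => ⟨PUnit.unit, trivial, zero_mem (DGMod.zero A).mulPosGrp⟩⟩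

instance : (barExact A).IsTriangulatedClosed₂ := .mk' <| by
  rintro T ⟨M, N, f, ⟨e⟩⟩ h₁ h₃
  exact (barExact A).prop_of_iso (Triangle.π₂.mapIso e).symm <| DGMod.BarExactAt.of_cone
    ((barExact A).prop_of_iso (Triangle.π₁.mapIso e) h₁)
    ((barExact A).prop_of_iso (Triangle.π₃.mapIso e) h₃)

end DGHot

/-! ### Perfect dg modules -/

namespace DGHot

variable {A : DGAlgebra.{w, u} k} {hA : A.ZeroDiff}

/-- The objects of `dgHot(A)` isomorphic to `L̂` for a right `A^0`-module `L` that is simple or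
zero. Zero is included so that the class is simple-minded in the sense of `IsSimpleMinded`. -/
def simples (hA : A.ZeroDiff) : ObjectProperty (DGHot A) :=
  ObjectProperty.map (fun L => IsZero L ∨ Simple L) (DGMod.hatFunctor hA)

theorem simples_hat (L : Type u) [AddCommGroup L] [Module (A.gr 0)ᵐᵒᵖ L]
    [IsSimpleModule (A.gr 0)ᵐᵒᵖ L] : simples hA ⟨DGMod.hat L hA⟩ :=
  ObjectProperty.prop_map_obj _ (DGMod.hatFunctor hA)
    (X := ModuleCat.of (A.gr 0)ᵐᵒᵖ L) (Or.inr simple_of_isSimpleModule)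

theorem simples_le {Q : ObjectProperty (DGHot A)} [Q.IsClosedUnderIsomorphisms] [Q.ContainsZero]
    (h : ∀ (L : Type u) [AddCommGroup L] [Module (A.gr 0)ᵐᵒᵖ L] [IsSimpleModule (A.gr 0)ᵐᵒᵖ L],
      Q ⟨DGMod.hat L hA⟩) : simples hA ≤ Q := by
  rintro X ⟨L, hL | hL, ⟨e⟩⟩
  · exact Q.prop_of_isZero (((DGMod.hatFunctor hA).map_isZero hL).of_iso e.symm)
  · have : IsSimpleModule (A.gr 0)ᵐᵒᵖ L := isSimpleModule_of_simple L
    exact Q.prop_of_iso e (h L)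

theorem isSimpleMinded_simples (hP : A.IsPositive) : IsSimpleMinded (simples hA) where
  of_iso e := by
    rintro ⟨L, hL, ⟨e'⟩⟩
    exact ⟨L, hL, ⟨e' ≪≫ e⟩⟩
  exists_zero := by
    obtain ⟨L, hL⟩ := HasZeroObject.zero (C := ModuleCat.{u} (A.gr 0)ᵐᵒᵖ)
    exact ⟨_, (DGMod.hatFunctor hA).map_isZero hL, ObjectProperty.prop_map_obj _ _ (Or.inl hL)⟩
  hom_eq_zero := by
    rintro X Y n hn ⟨L, -, ⟨e⟩⟩ ⟨L₁, -, ⟨e₁⟩⟩ f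
    obtain ⟨g, hg⟩ := mk_surj (e.hom ≫ f ≫ e₁.inv⟦n⟧')
    have h0 : e.hom ≫ f ≫ e₁.inv⟦n⟧' = 0 :=
      hg.symm.trans (congrArg mk (DGMod.hom_hat_shift_eq_zero (hA := hA) hP hn g))
    rwa [Preadditive.IsIso.comp_left_eq_zero, Preadditive.IsIso.comp_right_eq_zero] at h0
  isIso := by
    rintro X Y ⟨L, hL, ⟨e⟩⟩ ⟨L₁, hL₁, ⟨e₁⟩⟩ f hf
    obtain ⟨g, hg⟩ := (DGMod.hatFunctor hA).map_surjective (e.hom ≫ f ≫ e₁.inv)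
    have hg0 : g ≠ 0 := by
      rintro rfl
      rw [Functor.map_zero, eq_comm, Preadditive.IsIso.comp_left_eq_zero,
        Preadditive.IsIso.comp_right_eq_zero] at hg
      exact hf hg
    have : Simple L := hL.resolve_left fun h => hg0 (h.eq_of_src g 0)
    have : Simple L₁ := hL₁.resolve_left fun h => hg0 (h.eq_of_tgt g 0)
    have : IsIso g := isIso_of_hom_simple hg0
    have : IsIso (e.hom ≫ f ≫ e₁.inv) := hg ▸ inferInstance
    rwa [isIso_comp_left_iff, isIso_comp_right_iff] at this

theorem isDetectedBy_barExact (hP : A.IsPositive) : IsDetectedBy (simples hA) (barExact A) where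
  le_shift {n} hn := by
    rintro X ⟨L, -, ⟨e⟩⟩
    exact ((barExact A).shift n).prop_of_iso e
      (barExact_shift_iff.2 (DGMod.barExactAt_hat (L := L) (hA := hA) hP hn))
  isZero := by
    rintro X ⟨L, -, ⟨e⟩⟩ hX
    have : Subsingleton L :=
      DGMod.subsingleton_of_barExactAt_hat (hA := hA) hP ((barExact A).prop_of_iso e.symm hX)
    exact ((DGMod.hatFunctor hA).map_isZero (ModuleCat.isZero_of_subsingleton L)).of_iso e.symm

theorem dgPrae_eq_extensionHull (hP : A.IsPositive) :
    dgPrae hA = extensionHull (simples hA) Set.univ := by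
  have := isSimpleMinded_simples hP (hA := hA)
  refine le_antisymm (fun X hX => ?_) fun X hX Q _ _ hQ => ?_
  · exact hX _ inferInstance inferInstance fun L _ _ _ =>
      le_extensionHull (Set.mem_univ 0) _ (simples_hat L)
  · exact extensionHull_le_of_isTriangulated (simples_le hQ) X hX

/-- The isomorphism `A ≅ L̂` for `L = A^0`. -/
def selfIso (hA : A.ZeroDiff) :
    (⟨DGMod.self A⟩ : DGHot A) ≅ (DGMod.hatFunctor hA).obj (ModuleCat.of _ (A.gr 0)ᵐᵒᵖ) where
  hom := mk
    { lin :=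
        { toFun := fun a : A => DGMod.hatMk hA a (1 : (A.gr 0)ᵐᵒᵖ)
          map_add' := fun a b => DFunLike.congr_fun (map_add (DGMod.hatMk hA) (a : A) b) 1
          map_smul' := fun _ _ => rfl }
      map_mem := fun ha => DGMod.hatMk_mem hA ha 1
      comm := fun _ => rfl }
  inv := mk (DGMod.hatLift hA (M := DGMod.self A)
    { toFun := fun a₀ : (A.gr 0)ᵐᵒᵖ => (a₀.unop : A)
      map_zero' := rfl
      map_add' := fun _ _ => rfl }
    (fun a₀ => ⟨hA _ a₀.unop.2, a₀.unop.2⟩) fun _ _ => rfl)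
  hom_inv_id := mk_eq_of_lin fun a => one_mul (M := (A : Type u)) a
  inv_hom_id := congrArg mk <| DGMod.hat_hom_ext fun a₀ => by
    change DGMod.hatMk hA ((a₀.unop : A) * 1) (1 : (A.gr 0)ᵐᵒᵖ) = DGMod.hatMk hA 1 a₀
    rw [DGMod.hatMk_coe_mul]
    exact congrArg (DGMod.hatMk hA 1) (mul_one a₀)

section

variable [IsSemisimpleRing (A.gr 0)]

theorem extensionHull_simples_hat (hP : A.IsPositive) {L : Type u} [AddCommGroup L]
    [Module (A.gr 0)ᵐᵒᵖ L] (hL : IsFiniteLength (A.gr 0)ᵐᵒᵖ L) :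
    extensionHull (simples hA) Set.univ ⟨DGMod.hat L hA⟩ := by
  have := isSimpleMinded_simples hP (hA := hA)
  induction hL with
  | of_subsingleton =>
    exact ObjectProperty.prop_of_isZero _
      ((DGMod.hatFunctor hA).map_isZero (ModuleCat.isZero_of_subsingleton (ModuleCat.of _ _)))
  | @of_simple_quotient L _ _ N _ _ ih =>
    obtain ⟨N', hN⟩ := exists_isCompl N
    have : IsSimpleModule (A.gr 0)ᵐᵒᵖ N' :=
      IsSimpleModule.congr (N.quotientEquivOfIsCompl N' hN).symm
    have := preservesBinaryBiproducts_of_preservesBiproducts (DGMod.hatFunctor hA)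
    let e : ModuleCat.of (A.gr 0)ᵐᵒᵖ N ⊞ ModuleCat.of (A.gr 0)ᵐᵒᵖ N' ≅ ModuleCat.of _ L :=
      ModuleCat.biprodIsoProd _ _ ≪≫ (N.prodEquivOfIsCompl N' hN).toModuleIso
    refine ObjectProperty.prop_of_iso _
      (((DGMod.hatFunctor hA).mapBiprod (ModuleCat.of _ N) (ModuleCat.of _ N')).symm ≪≫
        (DGMod.hatFunctor hA).mapIso e) ?_
    exact ObjectProperty.ext_of_isTriangulatedClosed₂ _ _
      (binaryBiproductTriangle_distinguished _ _) ih
      (le_extensionHull (Set.mem_univ 0) _ (simples_hat N'))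

theorem nonempty_retract_hat_self (L : Type u) [AddCommGroup L] [Module (A.gr 0)ᵐᵒᵖ L]
    [IsSimpleModule (A.gr 0)ᵐᵒᵖ L] :
    Nonempty (Retract (⟨DGMod.hat L hA⟩ : DGHot A) ⟨DGMod.self A⟩) := by
  obtain ⟨l, hl⟩ := @exists_ne L (IsSimpleModule.nontrivial (A.gr 0)ᵐᵒᵖ L) 0
  let p := LinearMap.toSpanSingleton (A.gr 0)ᵐᵒᵖ L l
  have := Module.projective_of_isSemisimpleRing (A.gr 0)ᵐᵒᵖ L
  obtain ⟨s, hs⟩ := Module.projective_lifting_property p LinearMap.id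
    (IsSimpleModule.toSpanSingleton_surjective _ hl)
  let r : Retract (ModuleCat.of (A.gr 0)ᵐᵒᵖ L) (ModuleCat.of _ (A.gr 0)ᵐᵒᵖ) :=
    { i := ModuleCat.ofHom s
      r := ModuleCat.ofHom p
      retract := ModuleCat.hom_ext hs }
  exact ⟨(r.map (DGMod.hatFunctor hA)).trans (.ofIso (selfIso hA).symm)⟩

theorem dgPer_eq_extensionHull (hP : A.IsPositive) :
    dgPer A = extensionHull (simples hA) Set.univ := by
  have := isSimpleMinded_simples hP (hA := hA)
  refine le_antisymm (fun X hX => ?_) fun X hX Q _ _ hQ => ?_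
  · exact hX _ inferInstance inferInstance <| ObjectProperty.prop_of_iso _ (selfIso hA).symm <|
      extensionHull_simples_hat hP <|
        isFiniteLength_iff_isNoetherian_isArtinian.2 ⟨inferInstance, inferInstance⟩
  · refine extensionHull_le_of_isTriangulated (simples_le (hA := hA) fun L _ _ _ => ?_) X hX
    obtain ⟨r⟩ := nonempty_retract_hat_self (hA := hA) L
    exact Q.prop_of_retract r hQ

theorem dgPerSupp_iff (hP : A.IsPositive) {I : Set ℤ} {X : (dgPer A).FullSubcategory} :
    dgPerSupp hP I X ↔ extensionHull (simples hA) I X.obj := by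
  have := isSimpleMinded_simples hP (hA := hA)
  have hX : extensionHull (simples hA) Set.univ X.obj :=
    dgPer_eq_extensionHull (hA := hA) hP ▸ X.property
  rw [(isDetectedBy_barExact hP).extensionHull_iff hX]
  simp only [barExact_shift_iff, ← DGMod.notMem_suppH_bar_iff hP]
  exact Set.compl_subset_compl.symm

end

end DGHot

end

theorem theorem5p2 {k : Type w} [CommRing k] (A : DGAlgebra.{w, u} k)
    (P1 : A.IsPositive) (P2 : IsSemisimpleRing (A.gr 0)) (P3 : A.ZeroDiff) :
    DGHot.dgPrae P3 = DGHot.dgPer A ∧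
    ∃ t : Triangulated.TStructure (DGHot.dgPer A).FullSubcategory,
      (∀ n : ℤ, t.le n = DGHot.dgPerSupp P1 (Set.Iic n)) ∧
      (∀ n : ℤ, t.ge n = DGHot.dgPerSupp P1 (Set.Ici n)) ∧
      IsBoundedTStructure t ∧ IsNondegenerateTStructure t := by
  have := DGHot.isSimpleMinded_simples P1 (hA := P3)
  have hPrae := DGHot.dgPrae_eq_extensionHull P1 (hA := P3)
  have hPer := DGHot.dgPer_eq_extensionHull P1 (hA := P3)
  have hBounded := isBoundedTStructure_extensionTStructure hPer
  exact ⟨hPrae.trans hPer.symm, extensionTStructure (DGHot.simples P3) hPer,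
    fun _ => funext fun _ => propext (DGHot.dgPerSupp_iff P1).symm,
    fun _ => funext fun _ => propext (DGHot.dgPerSupp_iff P1).symm,
    hBounded, hBounded.isNondegenerateTStructure⟩
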